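/- \textbf{Symbolic heaps.} A symbolic heap is a formula $\varphi = \exists \mathbf{z}.\, \Sigma * P_1\mathbf{a}_1 * \cdots * P_m\mathbf{a}_m : \Pi$, where $\Sigma$ is a separating conjunction of finitely many points-to assertions $x \mapsto \mathbf{y}$ with $\mathbf{y}$ a non-empty tuple of variables ($\mathrm{emp}$ if there are none), $P_i\mathbf{a}_i$ are predicate calls, and $\Pi$ is a finite set of (in)equalities between variables. It has a tuple $\mathbf{x}$ of free variables and a tuple $\mathbf{z}$ of quantified variables; $\mathrm{Var}(\varphi)$ consists of these and the constant $\mathrm{null}$, which counts as a free variable of every symbolic heap. Symbolic heaps are considered up to renaming of variables. For $\alpha \in \mathbb{N}$ let $\mathrm{SH}^{\alpha}$ be the set of symbolic heaps with at most $\alpha$ free variables other than $\mathrm{null}$, and let $\mathrm{RSH}^{\alpha}$ be the set of \emph{reduced} ones, i.e. those with $m=0$. If $\tau_1,\dots,\tau_m$ are reduced and $\tau_i$ has as many free variables as $P_i$ has parameters, then $\varphi[P_1/\tau_1,\dots,P_m/\tau_m]$ is the reduced symbolic heap obtained by replacing each call $P_i\mathbf{a}_i$ by $\tau_i$, with the free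 variables of $\tau_i$ replaced by $\mathbf{a}_i$ and its quantified variables renamed apart. \textbf{Definite relationships.} Locations are positive integers, values are natural numbers, $\mathrm{null}$ has value $0$, and a heap is a finite partial map from locations to tuples of values. Let $\tau=\exists\mathbf{z}.\,\Sigma:\Pi$ be reduced and consider all pairs $(s,h)$ of a stack $s$ (interpreting free and quantified variables) and a heap $h$ with $s,h\models\Sigma:\Pi$ in the usual semantics of separation logic, in which the domain of $h$ consists of exactly the locations of the points-to assertions in $\Sigma$. Variables $x,y$ are \emph{definitely equal}, $x =_\tau y$, if $s(x)=s(y)$ for all such $(s,h)$; $x$ \emph{definitely points to} $y$ if for all such $(s,h)$, $s(x)\in\mathrm{dom}(h)$ and $s(y)$ occurs in the tuple $h(s(x))$; and $y$ is \emph{definitely reachable} from $x$, $x\leadsto_\tau y$, if there is a finite sequence of at least one definite points-to step, through variables of $\tau$, from $x$ to $y$. A reduced symbolic heap $\tau$ is \emph{garbage-free} if for every $y\in\mathrm{Var}(\tau)$ there is a free variable $x$ of $\tau$ (possibly $\mathrm{null}$) with $x=_\tau y$ or $x\leadsto_\tau y$. \textbf{Heap automata.} A heap automaton over $\mathrm{SH}^{\alpha}$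 consists of a finite set $Q$ of states, a set $F\subseteq Q$ of final states and a decidable relation $\Delta\subseteq Q^*\times \mathrm{SH}^{\alpha}\times Q$ such that $(\mathbf{q},\varphi,p)\in\Delta$ implies that $|\mathbf{q}|$ is the number of predicate calls of $\varphi$. It is required to be compositional: for all $p\in Q$, all $\varphi\in\mathrm{SH}^{\alpha}$ with $m\ge 0$ predicate calls $P_1\mathbf a_1,\dots,P_m\mathbf a_m$, and all $\tau_1,\dots,\tau_m\in\mathrm{RSH}^{\alpha}$ such that $\tau_i$ has $|\mathbf a_i|$ free variables, there is $\mathbf{q}\in Q^m$ with $(\mathbf{q},\varphi,p)\in\Delta$ and $(\varepsilon,\tau_i,q_i)\in\Delta$ for all $1\le i\le m$ if and only if $(\varepsilon,\varphi[P_1/\tau_1,\dots,P_m/\tau_m],p)\in\Delta$. It accepts the language $\{\tau\in\mathrm{RSH}^{\alpha} \mid \exists q\in F.\ (\varepsilon,\tau,q)\in\Delta\}$. \textbf{Lemma.} For every $\alpha\in\mathbb{N}$ there is a (compositional) heap automaton over $\mathrm{SH}^{\alpha}$ that accepts exactly the set of garbage-free symbolic heaps in $\mathrm{RSH}^{\alpha}$.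 -/

import Mathlib

/-! Symbolic heaps of separation logic, definite relationships between their variables,
and heap automata. -/

/-! ### Syntax -/

/-- Variables of a symbolic heap: the constant `null` (which counts as a free variable of every
symbolic heap), the `i`-th entry of the tuple of free variables, and the `j`-th entry of the tuple
of existentially quantified variables. Naming variables by their position in these two tuples
identifies symbolic heaps up to renaming of variables. -/
inductive SLVar where
  | null : SLVar
  | free (i : ℕ) : SLVar
  | bound (j : ℕ) : SLVar

/-- The points-to assertion `src ↦ tgt`. -/
structure PointsTo where
  src : SLVar
  tgt : List SLVar

/-- The predicate call `P args`. The predicate symbol is given by the number `pred` together with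
its arity `args.length`. -/
structure PredCall where
  pred : ℕ
  args : List SLVar

/-- The pure formulas `x = y` and `x ≠ y`. -/
inductive PureFormula where
  | eq (x y : SLVar) : PureFormula
  | ne (x y : SLVar) : PureFormula

/-- The symbolic heap `∃ z . Σ * Γ : Π` with `nfv` free variables (other than `null`) and `nbv`
existentially quantified variables. The spatial part `Σ` is the separating conjunction of the
points-to assertions in `spatial` (`emp` is the empty list), `Γ` is the separating conjunction of
the predicate calls in `calls`, and the finite set `Π` of pure formulas is listed in `pures`. -/
structure SymHeap where
  nfv : ℕ
  nbv : ℕ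
  spatial : List PointsTo
  calls : List PredCall
  pures : List PureFormula

namespace SymHeap

/-- The free variables, including `null`. -/
def freeVars (φ : SymHeap) : Set SLVar :=
  {x | x = SLVar.null ∨ ∃ i < φ.nfv, x = SLVar.free i}

/-- All variables: `null`, the free variables and the existentially quantified variables. -/
def vars (φ : SymHeap) : Set SLVar :=
  {x | x ∈ φ.freeVars ∨ ∃ j < φ.nbv, x = SLVar.bound j}

/-- Only variables of `φ` occur in its formulas, and right-hand sides of points-to assertions
are non-empty tuples. -/
structure WellFormed (φ : SymHeap) : Prop where
  spatial_mem : ∀ p ∈ φ.spatial, p.src ∈ φ.vars ∧ p.tgt ≠ [] ∧ ∀ y ∈ p.tgt, y ∈ φ.vars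
  calls_mem : ∀ c ∈ φ.calls, ∀ y ∈ c.args, y ∈ φ.vars
  eq_mem : ∀ x y, PureFormula.eq x y ∈ φ.pures → x ∈ φ.vars ∧ y ∈ φ.vars
  ne_mem : ∀ x y, PureFormula.ne x y ∈ φ.pures → x ∈ φ.vars ∧ y ∈ φ.vars

end SymHeap

/-- The set of symbolic heaps with at most `α` free variables (not counting `null`). -/
def SH (α : ℕ) : Set SymHeap :=
  {φ | φ.WellFormed ∧ φ.nfv ≤ α}

/-- The set of reduced symbolic heaps, i.e. those without predicate calls, with at most `α` free
variables (not counting `null`). -/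
def RSH (α : ℕ) : Set SymHeap :=
  {τ | τ ∈ SH α ∧ τ.calls = []}

/-! ### Replacement of predicate calls -/

/-- Substitutes the parameters `args` for the free variables and renames the `j`-th quantified
variable to the `(off + j)`-th one. -/
def SLVar.inst (args : List SLVar) (off : ℕ) : SLVar → SLVar
  | SLVar.null => SLVar.null
  | SLVar.free i => args.getD i SLVar.null
  | SLVar.bound j => SLVar.bound (off + j)

/-- Renaming of variables in a points-to assertion. -/
def PointsTo.map (f : SLVar → SLVar) (p : PointsTo) : PointsTo :=
  ⟨f p.src, p.tgt.map f⟩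

/-- Renaming of variables in a predicate call. -/
def PredCall.map (f : SLVar → SLVar) (c : PredCall) : PredCall :=
  ⟨c.pred, c.args.map f⟩

/-- Renaming of variables in a pure formula. -/
def PureFormula.map (f : SLVar → SLVar) : PureFormula → PureFormula
  | PureFormula.eq x y => PureFormula.eq (f x) (f y)
  | PureFormula.ne x y => PureFormula.ne (f x) (f y)

namespace SymHeap

/-- Adds to `ψ` a copy of `τ` in which the free variables are replaced by `args` and the quantified
variables are renamed apart from those of `ψ`. -/
def plug (ψ : SymHeap) (args : List SLVar) (τ : SymHeap) : SymHeap where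
  nfv := ψ.nfv
  nbv := ψ.nbv + τ.nbv
  spatial := ψ.spatial ++ τ.spatial.map (PointsTo.map (SLVar.inst args ψ.nbv))
  calls := ψ.calls ++ τ.calls.map (PredCall.map (SLVar.inst args ψ.nbv))
  pures := ψ.pures ++ τ.pures.map (PureFormula.map (SLVar.inst args ψ.nbv))

/-- The simultaneous replacement `φ[P₁ / τ₁, …, Pₘ / τₘ]` of all predicate calls `P₁, …, Pₘ` of
`φ` by the symbolic heaps `τ₁, …, τₘ`. -/
def replace (φ : SymHeap) (τs : List SymHeap) : SymHeap :=
  (φ.calls.zip τs).foldl (fun ψ cτ => ψ.plug cτ.1.args cτ.2) { φ with calls := [] }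

end SymHeap

/-! ### Semantics -/

/-- Heaps: finite partial functions from locations (positive natural numbers) to tuples of values.
Values are natural numbers, and `0` is the value of `null`. -/
structure SLHeap where
  cells : ℕ → Option (List ℕ)
  cells_null : cells 0 = none
  finite_dom : {l | cells l ≠ none}.Finite

/-- `h = h₁ ⊎ h₂`: the heap `h` is the union of the heaps `h₁` and `h₂`, whose domains are
disjoint. -/
def SLHeap.IsDisjointUnion (h h₁ h₂ : SLHeap) : Prop :=
  ∀ l, (h₁.cells l = none ∧ h.cells l = h₂.cells l) ∨
    (h₂.cells l = none ∧ h.cells l = h₁.cells l)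

/-- `s, h ⊨ x ↦ a`: the domain of `h` is `{s x}` and `h (s x) = s a`. -/
def PointsTo.Sat (s : SLVar → ℕ) (h : SLHeap) (p : PointsTo) : Prop :=
  h.cells (s p.src) = some (p.tgt.map s) ∧ ∀ l, l ≠ s p.src → h.cells l = none

/-- `s, h ⊨ Σ` for a separating conjunction `Σ` of points-to assertions. -/
def SpatialSat (s : SLVar → ℕ) : List PointsTo → SLHeap → Prop
  | [], h => ∀ l, h.cells l = none
  | p :: ps, h => ∃ h₁ h₂ : SLHeap, h.IsDisjointUnion h₁ h₂ ∧ p.Sat s h₁ ∧ SpatialSat s ps h₂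

/-- Satisfaction of a pure formula. -/
def PureFormula.Sat (s : SLVar → ℕ) : PureFormula → Prop
  | PureFormula.eq x y => s x = s y
  | PureFormula.ne x y => s x ≠ s y

namespace SymHeap

/-- `(s, h)` is a model of the quantifier-free body `Σ : Π` of the reduced symbolic heap `τ`; the
stack `s` interprets both the free and the quantified variables. -/
def BodyModel (τ : SymHeap) (s : SLVar → ℕ) (h : SLHeap) : Prop :=
  s SLVar.null = 0 ∧ SpatialSat s τ.spatial h ∧ ∀ π ∈ τ.pures, π.Sat s

/-- `x` and `y` are definitely equal: they are equal in every model. -/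
def DefEq (τ : SymHeap) (x y : SLVar) : Prop :=
  ∀ s h, τ.BodyModel s h → s x = s y

/-- `x` definitely points to `y`: in every model, `x` is allocated and the value of `y` occurs in
the tuple stored at the location `x`. -/
def DefPointsTo (τ : SymHeap) (x y : SLVar) : Prop :=
  ∀ s h, τ.BodyModel s h → ∃ v, h.cells (s x) = some v ∧ s y ∈ v

/-- `y` is definitely reachable from `x`. -/
inductive DefReach (τ : SymHeap) : SLVar → SLVar → Prop where
  | single {x y : SLVar} : τ.DefPointsTo x y → DefReach τ x y
  | step {x z y : SLVar} : z ∈ τ.vars → τ.DefPointsTo x z → DefReach τ z y → DefReach τ x y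

/-- Every variable is definitely equal to, or definitely reachable from, some free variable. -/
def GarbageFree (τ : SymHeap) : Prop :=
  ∀ y ∈ τ.vars, ∃ x ∈ τ.freeVars, τ.DefEq x y ∨ τ.DefReach x y

end SymHeap

/-- The set of garbage-free reduced symbolic heaps with at most `α` free variables. -/
def GFREE (α : ℕ) : Set SymHeap :=
  {τ | τ ∈ RSH α ∧ τ.GarbageFree}

/-! ### Encodings, needed to speak about decidable relations on symbolic heaps -/

def SLVar.equivCode : SLVar ≃ Option (ℕ ⊕ ℕ) where
  toFun
    | SLVar.null => none
    | SLVar.free i => some (Sum.inl i)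
    | SLVar.bound j => some (Sum.inr j)
  invFun
    | none => SLVar.null
    | some (Sum.inl i) => SLVar.free i
    | some (Sum.inr j) => SLVar.bound j
  left_inv x := by cases x <;> rfl
  right_inv x := by rcases x with _ | _ | _ <;> rfl

instance : Primcodable SLVar := Primcodable.ofEquiv _ SLVar.equivCode

def PointsTo.equivCode : PointsTo ≃ SLVar × List SLVar where
  toFun p := (p.src, p.tgt)
  invFun q := ⟨q.1, q.2⟩
  left_inv _ := rfl
  right_inv _ := rfl

instance : Primcodable PointsTo := Primcodable.ofEquiv _ PointsTo.equivCode

def PredCall.equivCode : PredCall ≃ ℕ × List SLVar where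
  toFun c := (c.pred, c.args)
  invFun q := ⟨q.1, q.2⟩
  left_inv _ := rfl
  right_inv _ := rfl

instance : Primcodable PredCall := Primcodable.ofEquiv _ PredCall.equivCode

def PureFormula.equivCode : PureFormula ≃ (SLVar × SLVar) ⊕ (SLVar × SLVar) where
  toFun
    | PureFormula.eq x y => Sum.inl (x, y)
    | PureFormula.ne x y => Sum.inr (x, y)
  invFun
    | Sum.inl q => PureFormula.eq q.1 q.2
    | Sum.inr q => PureFormula.ne q.1 q.2
  left_inv x := by cases x <;> rfl
  right_inv x := by rcases x with _ | _ <;> rfl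

instance : Primcodable PureFormula := Primcodable.ofEquiv _ PureFormula.equivCode

def SymHeap.equivCode :
    SymHeap ≃ ℕ × ℕ × List PointsTo × List PredCall × List PureFormula where
  toFun φ := (φ.nfv, φ.nbv, φ.spatial, φ.calls, φ.pures)
  invFun q := ⟨q.1, q.2.1, q.2.2.1, q.2.2.2.1, q.2.2.2.2⟩
  left_inv _ := rfl
  right_inv _ := rfl

instance : Primcodable SymHeap := Primcodable.ofEquiv _ SymHeap.equivCode

/-! ### Heap automata -/

/-- A heap automaton over the symbolic heaps with at most `α` free variables: a finite set of
states (`Fin numStates`), a set of final states, and a decidable transition relation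
`Δ ⊆ Q* × SH α × Q` such that `(q, φ, p) ∈ Δ` implies that the length of `q` is the number of
predicate calls of `φ`. -/
structure HeapAutomaton (α : ℕ) where
  numStates : ℕ
  final : Set (Fin numStates)
  Δ : List (Fin numStates) → SymHeap → Fin numStates → Prop
  Δ_mem : ∀ q φ p, Δ q φ p → φ ∈ SH α
  Δ_length : ∀ q φ p, Δ q φ p → q.length = φ.calls.length
  Δ_decidable :
    ComputablePred fun t : List (Fin numStates) × SymHeap × Fin numStates => Δ t.1 t.2.1 t.2.2

namespace HeapAutomaton

variable {α : ℕ}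

/-- The compositionality property. The heaps `τ₁, …, τₘ` replacing the predicate calls of `φ` must
have as many free variables as the corresponding predicate has parameters. -/
def Compositional (A : HeapAutomaton α) : Prop :=
  ∀ (p : Fin A.numStates) (φ : SymHeap) (τs : List SymHeap), φ ∈ SH α →
    List.Forall₂ (fun (c : PredCall) (τ : SymHeap) => τ ∈ RSH α ∧ τ.nfv = c.args.length)
      φ.calls τs →
    ((∃ q : List (Fin A.numStates), A.Δ q φ p ∧ List.Forall₂ (fun τ r => A.Δ [] τ r) τs q) ↔
      A.Δ [] (φ.replace τs) p)

/-- The language accepted by a heap automaton: all reduced symbolic heaps that are assigned a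
final state. -/
def language (A : HeapAutomaton α) : Set SymHeap :=
  {τ | τ ∈ RSH α ∧ ∃ q ∈ A.final, A.Δ [] τ q}

end HeapAutomaton

/-! The definite relationships of a reduced symbolic heap `τ` are those that can be derived from its
formulas. Let `Eqv` be the equivalence relation generated by the equations of `τ`, and collect the
inequalities that hold in every model: those of the pure part, and those which express that the
left-hand sides of points-to assertions are distinct and non-null. If some derivable equation
contradicts one of these inequalities (`Unsat`), then `τ` has no model and is trivially
garbage-free. Otherwise there is a generic model, in which variables are equal only if they are
derivably so (`exists_generic_model`). Hence `τ` is garbage-free if and only if it is contradictory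
or every variable can be reached from a free one along equations and points-to assertions
(`garbageFree_iff`).

All of this can be computed compositionally. Replacing a predicate call by `τ` glues the graph of
`τ` to the surrounding graph along the free variables of `τ`. A path of the glued graph decomposes
into pieces that run within one of the parts and connect interface variables
(`Gluing.path_cases`), so paths, and likewise contradictions, depend only on the following
information about `τ`: which of its free variables are derivably equal, derivably different,
allocated, and reachable from each other; whether `τ` is contradictory; and whether every variable
is reachable from a free one (`Simulates.plug`). For at most `α` free variables these are finitely
many primitive recursive `Observation`s, and the set of those which hold is the state of `τ`. The
automaton computes the state reached from `φ` and given states by replacing the predicate calls of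
`φ` by fixed representatives of these states; this is computable because there are only finitely
many states, and compositional by `state_replace_eq`. -/

/-! ### Paths along a list of edges -/

/-- `EdgePath E x y`: there is a (possibly empty) path from `x` to `y` along the edges in `E`. -/
def EdgePath {V : Type*} (E : List (V × V)) : V → V → Prop :=
  Relation.ReflTransGen fun x y => (x, y) ∈ E

namespace EdgePath

variable {V W : Type*}

theorem refl (E : List (V × V)) (x : V) : EdgePath E x x := Relation.ReflTransGen.refl

theorem trans {E : List (V × V)} {x y z : V} (h₁ : EdgePath E x y) (h₂ : EdgePath E y z) :
    EdgePath E x z :=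
  Relation.ReflTransGen.trans h₁ h₂

theorem single {E : List (V × V)} {x y : V} (h : (x, y) ∈ E) : EdgePath E x y :=
  Relation.ReflTransGen.single h

theorem mono {E E' : List (V × V)} (h : E ⊆ E') {x y : V} (hp : EdgePath E x y) :
    EdgePath E' x y := by
  induction hp with
  | refl => exact .refl _ _
  | tail _ he ih => exact ih.trans (.single (h he))

theorem map (f : W → V) {E : List (W × W)} {x y : W} (h : EdgePath E x y) :
    EdgePath (E.map (Prod.map f f)) (f x) (f y) := by
  induction h with
  | refl => exact .refl _ _
  | tail _ he ih => exact ih.trans (.single (List.mem_map.2 ⟨_, he, rfl⟩))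

theorem symm {E : List (V × V)} (hE : ∀ x y, (x, y) ∈ E → (y, x) ∈ E) {x y : V}
    (h : EdgePath E x y) : EdgePath E y x := by
  induction h with
  | refl => exact .refl _ _
  | tail _ he ih => exact (single (hE _ _ he)).trans ih

end EdgePath

/-! ### Gluing two graphs along an interface -/

/-- A graph with vertices in `B` is glued by `f` to a graph with vertices in `A`. Its vertices in
the interface `F` are identified with vertices in `U ⊆ A`, all others are kept apart from `A` and
from each other. -/
structure Gluing {V W : Type*} (A U : Set V) (B F : Set W) (f : W → V) : Prop where
  subset : U ⊆ A
  mapsTo : ∀ x ∈ F, f x ∈ U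
  mem_of_mem : ∀ x ∈ B, f x ∈ A → x ∈ F
  inj : ∀ x ∈ B, ∀ y ∈ B, x ∉ F → f x = f y → x = y

/-- The edges between vertices in `U` of the glued graph that summarise a path inside one of its
two parts. -/
def Shortcut {V W : Type*} (U : Set V) (F : Set W) (f : W → V) (E₁ : List (V × V))
    (E₂ : List (W × W)) (x y : V) : Prop :=
  (x ∈ U ∧ y ∈ U ∧ EdgePath E₁ x y) ∨ ∃ u ∈ F, ∃ v ∈ F, EdgePath E₂ u v ∧ x = f u ∧ y = f v

/-- Every vertex of the edges in `E` is in `A`. -/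
def EdgesIn {V : Type*} (A : Set V) (E : List (V × V)) : Prop :=
  ∀ e ∈ E, e.1 ∈ A ∧ e.2 ∈ A

/-- The edges of the glued graph. -/
def glue {V W : Type*} (f : W → V) (E₁ : List (V × V)) (E₂ : List (W × W)) : List (V × V) :=
  E₁ ++ E₂.map (Prod.map f f)

theorem mem_glue {V W : Type*} {f : W → V} {E₁ : List (V × V)} {E₂ : List (W × W)} {e : V × V} :
    e ∈ glue f E₁ E₂ ↔ e ∈ E₁ ∨ ∃ x y, (x, y) ∈ E₂ ∧ e = (f x, f y) := by
  simp [glue, Prod.ext_iff, eq_comm]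

theorem EdgePath.glue_left {V W : Type*} {f : W → V} {E₁ : List (V × V)} {E₂ : List (W × W)}
    {x y : V} (h : EdgePath E₁ x y) : EdgePath (glue f E₁ E₂) x y :=
  h.mono (List.subset_append_left _ _)

theorem EdgePath.glue_right {V W : Type*} {f : W → V} {E₁ : List (V × V)} {E₂ : List (W × W)}
    {x y : W} (h : EdgePath E₂ x y) : EdgePath (glue f E₁ E₂) (f x) (f y) :=
  (h.map f).mono (List.subset_append_right _ _)

namespace Gluing

variable {V W : Type*} {A U : Set V} {B F : Set W} {f : W → V} {E₁ : List (V × V)}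
  {E₂ : List (W × W)}

/-- A path from `U` to a vertex of one of the two parts decomposes into shortcuts, followed by a
path inside that part. -/
theorem path_cases (g : Gluing A U B F f) (h₁ : EdgesIn A E₁) (h₂ : EdgesIn B E₂) {a b : V}
    (ha : a ∈ U) (h : EdgePath (glue f E₁ E₂) a b) :
    (b ∈ A → ∃ v ∈ U, Relation.ReflTransGen (Shortcut U F f E₁ E₂) a v ∧ EdgePath E₁ v b) ∧
    ∀ y ∈ B, b = f y →
      ∃ u ∈ F, Relation.ReflTransGen (Shortcut U F f E₁ E₂) a (f u) ∧ EdgePath E₂ u y := by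
  -- It suffices to treat vertices of the second part that are off the interface.
  suffices H : (∃ v ∈ U, b ∈ A ∧
        Relation.ReflTransGen (Shortcut U F f E₁ E₂) a v ∧ EdgePath E₁ v b) ∨
      ∃ u ∈ F, ∃ y ∈ B, y ∉ F ∧ b = f y ∧
        Relation.ReflTransGen (Shortcut U F f E₁ E₂) a (f u) ∧ EdgePath E₂ u y by
    rcases H with ⟨v, hv, hb, hs, hp⟩ | ⟨u, hu, y, hy, hyF, rfl, hs, hp⟩
    · refine ⟨fun _ => ⟨v, hv, hs, hp⟩, ?_⟩
      rintro y hy rfl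
      have hyF := g.mem_of_mem y hy hb
      exact ⟨y, hyF, hs.tail (.inl ⟨hv, g.mapsTo y hyF, hp⟩), .refl _ _⟩
    · refine ⟨fun hb => absurd (g.mem_of_mem y hy hb) hyF, ?_⟩
      intro y' hy' he
      obtain rfl := g.inj y hy y' hy' hyF he
      exact ⟨u, hu, hs, hp⟩
  induction h with
  | refl => exact .inl ⟨a, ha, g.subset ha, .refl, .refl _ _⟩
  | @tail b c _ hbc ih =>
    rcases mem_glue.1 hbc with he | ⟨y, z, he, hyz⟩
    · have hbA := (h₁ _ he).1
      rcases ih with ⟨v, hv, -, hs, hp⟩ | ⟨u, hu, y, hy, hyF, rfl, hs, hp⟩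
      · exact .inl ⟨v, hv, (h₁ _ he).2, hs, hp.trans (.single he)⟩
      · exact absurd (g.mem_of_mem y hy hbA) hyF
    · obtain ⟨rfl, rfl⟩ := Prod.ext_iff.1 hyz
      obtain ⟨hy, hz⟩ := h₂ _ he
      have key : ∃ u ∈ F,
          Relation.ReflTransGen (Shortcut U F f E₁ E₂) a (f u) ∧ EdgePath E₂ u y := by
        rcases ih with ⟨v, hv, hb, hs, hp⟩ | ⟨u, hu, y', hy', hyF, hyy, hs, hp⟩
        · have hyF := g.mem_of_mem y hy hb
          exact ⟨y, hyF, hs.tail (.inl ⟨hv, g.mapsTo y hyF, hp⟩), .refl _ _⟩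
        · obtain rfl := g.inj y' hy' y hy hyF hyy.symm
          exact ⟨u, hu, hs, hp⟩
      obtain ⟨u, hu, hs, hp⟩ := key
      have hp' := hp.trans (.single he)
      by_cases hzF : z ∈ F
      · exact .inl ⟨f z, g.mapsTo z hzF, g.subset (g.mapsTo z hzF),
          hs.tail (.inr ⟨u, hu, z, hzF, hp', rfl, rfl⟩), .refl _ _⟩
      · exact .inr ⟨u, hu, z, hz, hzF, rfl, hs, hp'⟩

theorem path_left (g : Gluing A U B F f) (h₁ : EdgesIn A E₁) (h₂ : EdgesIn B E₂) {a b : V}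
    (ha : a ∈ U) (hb : b ∈ A) (h : EdgePath (glue f E₁ E₂) a b) :
    ∃ v ∈ U, Relation.ReflTransGen (Shortcut U F f E₁ E₂) a v ∧ EdgePath E₁ v b :=
  (g.path_cases h₁ h₂ ha h).1 hb

theorem path_right (g : Gluing A U B F f) (h₁ : EdgesIn A E₁) (h₂ : EdgesIn B E₂) {a : V} {y : W}
    (ha : a ∈ U) (hy : y ∈ B) (h : EdgePath (glue f E₁ E₂) a (f y)) :
    ∃ u ∈ F, Relation.ReflTransGen (Shortcut U F f E₁ E₂) a (f u) ∧ EdgePath E₂ u y :=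
  (g.path_cases h₁ h₂ ha h).2 y hy rfl

/-- A path starting in the first part stays inside that part or visits `U`. -/
theorem exit_left (g : Gluing A U B F f) (h₁ : EdgesIn A E₁) (h₂ : EdgesIn B E₂) {a b : V}
    (ha : a ∈ A) (h : EdgePath (glue f E₁ E₂) a b) :
    (b ∈ A ∧ EdgePath E₁ a b) ∨ ∃ v ∈ U, EdgePath E₁ a v ∧ EdgePath (glue f E₁ E₂) v b := by
  induction h with
  | refl => exact .inl ⟨ha, .refl _ _⟩
  | @tail b c _ hbc ih =>
    rcases ih with ⟨hb, hp⟩ | ⟨v, hv, hp, hq⟩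
    · rcases mem_glue.1 hbc with he | ⟨y, z, he, hyz⟩
      · exact .inl ⟨(h₁ _ he).2, hp.trans (.single he)⟩
      · obtain ⟨rfl, -⟩ := Prod.ext_iff.1 hyz
        exact .inr ⟨_, g.mapsTo y (g.mem_of_mem y (h₂ _ he).1 hb), hp, .single hbc⟩
    · exact .inr ⟨v, hv, hp, hq.trans (.single hbc)⟩

/-- A path starting in the second part stays inside that part or visits the interface. -/
theorem exit_right (g : Gluing A U B F f) (h₁ : EdgesIn A E₁) (h₂ : EdgesIn B E₂) {x : W} {b : V}
    (hx : x ∈ B) (h : EdgePath (glue f E₁ E₂) (f x) b) :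
    (∃ y ∈ B, b = f y ∧ EdgePath E₂ x y) ∨
      ∃ u ∈ F, EdgePath E₂ x u ∧ EdgePath (glue f E₁ E₂) (f u) b := by
  induction h with
  | refl => exact .inl ⟨x, hx, rfl, .refl _ _⟩
  | @tail b c _ hbc ih =>
    rcases ih with ⟨y, hy, rfl, hp⟩ | ⟨u, hu, hp, hq⟩
    · by_cases hyF : y ∈ F
      · exact .inr ⟨y, hyF, hp, .single hbc⟩
      rcases mem_glue.1 hbc with he | ⟨y', z, he, hyz⟩
      · exact absurd (g.mem_of_mem y hy (h₁ _ he).1) hyF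
      · obtain ⟨hyy, rfl⟩ := Prod.ext_iff.1 hyz
        obtain rfl := g.inj y hy y' (h₂ _ he).1 hyF hyy
        exact .inl ⟨z, (h₂ _ he).2, rfl, hp.trans (.single he)⟩
    · exact .inr ⟨u, hu, hp, hq.trans (.single hbc)⟩

/-- A path between two vertices of the first part stays inside that part or connects two vertices
of `U`. -/
theorem path_left_left (g : Gluing A U B F f) (h₁ : EdgesIn A E₁) (h₂ : EdgesIn B E₂) {a b : V}
    (ha : a ∈ A) (hb : b ∈ A) (h : EdgePath (glue f E₁ E₂) a b) :
    EdgePath E₁ a b ∨ ∃ v ∈ U, ∃ w ∈ U, EdgePath E₁ a v ∧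
      Relation.ReflTransGen (Shortcut U F f E₁ E₂) v w ∧ EdgePath E₁ w b := by
  rcases g.exit_left h₁ h₂ ha h with ⟨-, hp⟩ | ⟨v, hv, hp, hq⟩
  · exact .inl hp
  · obtain ⟨w, hw, hs, hr⟩ := g.path_left h₁ h₂ hv hb hq
    exact .inr ⟨v, hv, w, hw, hp, hs, hr⟩

/-- A path between two vertices of the second part stays inside that part or connects two vertices
of the interface. -/
theorem path_right_right (g : Gluing A U B F f) (h₁ : EdgesIn A E₁) (h₂ : EdgesIn B E₂) {x y : W}
    (hx : x ∈ B) (hy : y ∈ B) (h : EdgePath (glue f E₁ E₂) (f x) (f y)) :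
    EdgePath E₂ x y ∨ ∃ u ∈ F, ∃ v ∈ F, EdgePath E₂ x u ∧
      Relation.ReflTransGen (Shortcut U F f E₁ E₂) (f u) (f v) ∧ EdgePath E₂ v y := by
  have key : ∀ u ∈ F, EdgePath E₂ x u → EdgePath (glue f E₁ E₂) (f u) (f y) →
      ∃ u ∈ F, ∃ v ∈ F, EdgePath E₂ x u ∧
        Relation.ReflTransGen (Shortcut U F f E₁ E₂) (f u) (f v) ∧ EdgePath E₂ v y := by
    intro u hu hp hq
    obtain ⟨v, hv, hs, hr⟩ := g.path_right h₁ h₂ (g.mapsTo u hu) hy hq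
    exact ⟨u, hu, v, hv, hp, hs, hr⟩
  rcases g.exit_right h₁ h₂ hx h with ⟨y', hy', he, hp⟩ | ⟨u, hu, hp, hq⟩
  · by_cases hF : y' ∈ F
    · exact .inr (key y' hF hp (he ▸ .refl _ _))
    · obtain rfl := g.inj y' hy' y hy hF he.symm
      exact .inl hp
  · exact .inr (key u hu hp hq)

/-- A path from the first to the second part connects a vertex of `U` to the interface. -/
theorem path_left_right (g : Gluing A U B F f) (h₁ : EdgesIn A E₁) (h₂ : EdgesIn B E₂) {a : V}
    {y : W} (ha : a ∈ A) (hy : y ∈ B) (h : EdgePath (glue f E₁ E₂) a (f y)) :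
    ∃ v ∈ U, ∃ u ∈ F, EdgePath E₁ a v ∧
      Relation.ReflTransGen (Shortcut U F f E₁ E₂) v (f u) ∧ EdgePath E₂ u y := by
  obtain ⟨v, hv, hp, hq⟩ : ∃ v ∈ U, EdgePath E₁ a v ∧ EdgePath (glue f E₁ E₂) v (f y) := by
    rcases g.exit_left h₁ h₂ ha h with ⟨hb, hp⟩ | h'
    · exact ⟨f y, g.mapsTo y (g.mem_of_mem y hy hb), hp, .refl _ _⟩
    · exact h'
  obtain ⟨u, hu, hs, hr⟩ := g.path_right h₁ h₂ hv hy hq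
  exact ⟨v, hv, u, hu, hp, hs, hr⟩

end Gluing

/-- Shortcuts only depend on the paths between interface vertices in the two parts. -/
theorem EdgePath.of_shortcuts {V W : Type*} {U : Set V} {F : Set W} {f f' : W → V}
    {E₁ E₁' : List (V × V)} {E₂ E₂' : List (W × W)} (hf : ∀ x ∈ F, f x = f' x)
    (h₁ : ∀ x ∈ U, ∀ y ∈ U, EdgePath E₁ x y → EdgePath E₁' x y)
    (h₂ : ∀ x ∈ F, ∀ y ∈ F, EdgePath E₂ x y → EdgePath E₂' x y) {x y : V}
    (h : Relation.ReflTransGen (Shortcut U F f E₁ E₂) x y) : EdgePath (glue f' E₁' E₂') x y := by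
  induction h with
  | refl => exact .refl _ _
  | tail _ hs ih =>
    refine ih.trans ?_
    rcases hs with ⟨hx, hy, hp⟩ | ⟨u, hu, v, hv, hp, rfl, rfl⟩
    · exact (h₁ _ hx _ hy hp).glue_left
    · rw [hf u hu, hf v hv]
      exact (h₂ _ hu _ hv hp).glue_right

/-! ### The constraints imposed by a reduced symbolic heap -/

/-- The pairs `(x, y)` with `x` before `y` in the list. -/
def orderedPairs {V : Type*} (l : List V) : List (V × V) :=
  List.rec [] (fun a l ih => l.map (Prod.mk a) ++ ih) l

@[simp]
theorem orderedPairs_nil {V : Type*} : orderedPairs ([] : List V) = [] := rfl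

@[simp]
theorem orderedPairs_cons {V : Type*} (a : V) (l : List V) :
    orderedPairs (a :: l) = l.map (Prod.mk a) ++ orderedPairs l := rfl

theorem mem_orderedPairs_append {V : Type*} {l₁ l₂ : List V} {e : V × V} :
    e ∈ orderedPairs (l₁ ++ l₂) ↔
      e ∈ orderedPairs l₁ ∨ e ∈ orderedPairs l₂ ∨ e.1 ∈ l₁ ∧ e.2 ∈ l₂ := by
  obtain ⟨x, y⟩ := e
  induction l₁ with
  | nil => simp
  | cons a l ih =>
    simp only [List.cons_append, orderedPairs_cons, List.map_append, List.mem_append, ih,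
      List.mem_map, Prod.mk.injEq, exists_eq_right_right, List.mem_cons]
    grind

theorem orderedPairs_map {V W : Type*} (f : V → W) (l : List V) :
    orderedPairs (l.map f) = (orderedPairs l).map (Prod.map f f) := by
  induction l with
  | nil => rfl
  | cons a l ih => simp [ih, Function.comp_def]

theorem mem_of_mem_orderedPairs {V : Type*} {l : List V} {e : V × V} (h : e ∈ orderedPairs l) :
    e.1 ∈ l ∧ e.2 ∈ l := by
  induction l with
  | nil => simp at h
  | cons a l ih =>
    rcases List.mem_append.1 h with h | h
    · obtain ⟨b, hb, rfl⟩ := List.mem_map.1 h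
      simp [hb]
    · simp [ih h]

/-- Both orientations of the equality expressed by a pure formula. -/
def PureFormula.eqEdges : PureFormula → List (SLVar × SLVar)
  | eq x y => [(x, y), (y, x)]
  | ne _ _ => []

/-- The inequality expressed by a pure formula. -/
def PureFormula.neqs : PureFormula → List (SLVar × SLVar)
  | eq _ _ => []
  | ne x y => [(x, y)]

/-- The edges from the left-hand side to the entries of the right-hand side. -/
def PointsTo.edges (p : PointsTo) : List (SLVar × SLVar) :=
  p.tgt.map (Prod.mk p.src)

namespace SymHeap

/-- The equalities of the pure part, in both orientations. -/
def eqEdges (τ : SymHeap) : List (SLVar × SLVar) :=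
  τ.pures.flatMap PureFormula.eqEdges

/-- The edges along which variables are reached: equalities and points-to assertions. -/
def reachEdges (τ : SymHeap) : List (SLVar × SLVar) :=
  τ.eqEdges ++ τ.spatial.flatMap PointsTo.edges

/-- The left-hand sides of the points-to assertions. -/
def sources (τ : SymHeap) : List SLVar :=
  τ.spatial.map PointsTo.src

/-- The pairs of variables which are different in every model: those given by the pure part, and
those given by the spatial part, whose left-hand sides are allocated separately, none of them at
`null`. -/
def neqs (τ : SymHeap) : List (SLVar × SLVar) :=
  τ.pures.flatMap PureFormula.neqs ++
    (τ.sources.map (fun x => (x, SLVar.null)) ++ orderedPairs τ.sources)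

/-- Equality of variables as derived from the pure part. -/
def Eqv (τ : SymHeap) : SLVar → SLVar → Prop :=
  EdgePath τ.eqEdges

/-- Reachability along equalities and points-to assertions. -/
def Reach (τ : SymHeap) : SLVar → SLVar → Prop :=
  EdgePath τ.reachEdges

/-- `x` is derivably equal to the left-hand side of a points-to assertion. -/
def Alloc (τ : SymHeap) (x : SLVar) : Prop :=
  ∃ z ∈ τ.sources, τ.Eqv x z

/-- `x` and `y` are derivably different. -/
def Neq (τ : SymHeap) (x y : SLVar) : Prop :=
  ∃ e ∈ τ.neqs, τ.Eqv x e.1 ∧ τ.Eqv y e.2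

/-- The constraints are contradictory. -/
def Unsat (τ : SymHeap) : Prop :=
  ∃ e ∈ τ.neqs, τ.Eqv e.1 e.2

/-- Every variable of `τ` is reachable from `U`. -/
def Covered (τ : SymHeap) (U : Set SLVar) : Prop :=
  ∀ y ∈ τ.vars, ∃ x ∈ U, τ.Reach x y

theorem Eqv.symm {τ : SymHeap} {x y : SLVar} (h : τ.Eqv x y) : τ.Eqv y x := by
  refine EdgePath.symm (fun x y hxy => ?_) h
  obtain ⟨π, hπ, hxy⟩ := List.mem_flatMap.1 hxy
  refine List.mem_flatMap.2 ⟨π, hπ, ?_⟩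
  cases π <;> simp_all [PureFormula.eqEdges, or_comm, and_comm]

theorem Eqv.trans {τ : SymHeap} {x y z : SLVar} (h : τ.Eqv x y) (h' : τ.Eqv y z) : τ.Eqv x z :=
  EdgePath.trans h h'

theorem null_mem_freeVars (τ : SymHeap) : SLVar.null ∈ τ.freeVars := .inl rfl

theorem freeVars_subset_vars (τ : SymHeap) : τ.freeVars ⊆ τ.vars := fun _ h => .inl h

theorem null_mem_vars (τ : SymHeap) : SLVar.null ∈ τ.vars := .inl (.inl rfl)

namespace WellFormed

variable {τ : SymHeap} (h : τ.WellFormed)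
include h

theorem edgesIn_eqEdges : EdgesIn τ.vars τ.eqEdges := by
  intro e he
  obtain ⟨π, hπ, he⟩ := List.mem_flatMap.1 he
  cases π with
  | eq x y =>
    have := h.eq_mem x y hπ
    simp only [PureFormula.eqEdges, List.mem_cons, List.not_mem_nil, or_false] at he
    rcases he with rfl | rfl
    exacts [this, this.symm]
  | ne x y => simp [PureFormula.eqEdges] at he

theorem sources_mem {x : SLVar} (hx : x ∈ τ.sources) : x ∈ τ.vars := by
  obtain ⟨p, hp, rfl⟩ := List.mem_map.1 hx
  exact (h.spatial_mem p hp).1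

theorem edgesIn_reachEdges : EdgesIn τ.vars τ.reachEdges := by
  intro e he
  rcases List.mem_append.1 he with he | he
  · exact h.edgesIn_eqEdges e he
  · obtain ⟨p, hp, he⟩ := List.mem_flatMap.1 he
    obtain ⟨y, hy, rfl⟩ := List.mem_map.1 he
    have := h.spatial_mem p hp
    exact ⟨this.1, this.2.2 y hy⟩

theorem edgesIn_neqs : EdgesIn τ.vars τ.neqs := by
  intro e he
  rcases List.mem_append.1 he with he | he
  · obtain ⟨π, hπ, he⟩ := List.mem_flatMap.1 he
    cases π with
    | eq x y => simp [PureFormula.neqs] at he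
    | ne x y =>
      obtain rfl : e = (x, y) := by simpa [PureFormula.neqs] using he
      exact h.ne_mem x y hπ
  rcases List.mem_append.1 he with he | he
  · obtain ⟨x, hx, rfl⟩ := List.mem_map.1 he
    exact ⟨h.sources_mem hx, τ.null_mem_vars⟩
  · have := mem_of_mem_orderedPairs he
    exact ⟨h.sources_mem this.1, h.sources_mem this.2⟩

end WellFormed

/-! ### The constraints of a symbolic heap with a replaced predicate call -/

variable (ψ τ : SymHeap) (args : List SLVar)

theorem eqEdges_plug :
    (ψ.plug args τ).eqEdges = glue (SLVar.inst args ψ.nbv) ψ.eqEdges τ.eqEdges := by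
  simp only [eqEdges, plug, glue, List.flatMap_append, List.flatMap_map, List.map_flatMap]
  congr 2
  funext π
  cases π <;> rfl

theorem reachEdges_plug (e : SLVar × SLVar) :
    e ∈ (ψ.plug args τ).reachEdges ↔
      e ∈ glue (SLVar.inst args ψ.nbv) ψ.reachEdges τ.reachEdges := by
  have h : (ψ.plug args τ).spatial.flatMap PointsTo.edges = glue (SLVar.inst args ψ.nbv)
      (ψ.spatial.flatMap PointsTo.edges) (τ.spatial.flatMap PointsTo.edges) := by
    simp only [plug, glue, List.flatMap_append, List.flatMap_map, List.map_flatMap]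
    congr 2
    funext p
    simp [PointsTo.edges, PointsTo.map, Function.comp_def]
  simp only [reachEdges, eqEdges_plug, h, glue, List.mem_append, List.map_append]
  tauto

theorem sources_plug :
    (ψ.plug args τ).sources = ψ.sources ++ τ.sources.map (SLVar.inst args ψ.nbv) := by
  simp [sources, plug, PointsTo.map, Function.comp_def]

theorem mem_neqs_plug (e : SLVar × SLVar) :
    e ∈ (ψ.plug args τ).neqs ↔ e ∈ ψ.neqs ∨
      (∃ d ∈ τ.neqs, e = Prod.map (SLVar.inst args ψ.nbv) (SLVar.inst args ψ.nbv) d) ∨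
      ∃ x ∈ ψ.sources, ∃ y ∈ τ.sources, e = (x, SLVar.inst args ψ.nbv y) := by
  set f := SLVar.inst args ψ.nbv with hf
  have h₁ : (ψ.plug args τ).pures.flatMap PureFormula.neqs =
      ψ.pures.flatMap PureFormula.neqs ++
        (τ.pures.flatMap PureFormula.neqs).map (Prod.map f f) := by
    simp only [plug, List.flatMap_append, List.flatMap_map, List.map_flatMap]
    congr 2
    funext π
    cases π <;> rfl
  have h₂ : (τ.sources.map f).map (fun x => (x, SLVar.null)) =
      (τ.sources.map (fun x => (x, SLVar.null))).map (Prod.map f f) := by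
    simp [Function.comp_def, hf, SLVar.inst]
  simp only [neqs, h₁, sources_plug, ← hf, List.map_append, h₂, List.mem_append,
    mem_orderedPairs_append, orderedPairs_map]
  have h₃ : (e.1 ∈ ψ.sources ∧ e.2 ∈ τ.sources.map f) ↔
      ∃ x ∈ ψ.sources, ∃ y ∈ τ.sources, e = (x, f y) := by
    obtain ⟨a, b⟩ := e
    simp only [List.mem_map, Prod.mk.injEq]
    grind
  rw [h₃]
  simp only [or_and_right, exists_or, List.mem_map (f := Prod.map f f), eq_comm (a := e)]
  apply Iff.of_eq
  ac_rfl

theorem mem_vars_plug (y : SLVar) :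
    y ∈ (ψ.plug args τ).vars ↔ y ∈ ψ.vars ∨ ∃ j < τ.nbv, y = SLVar.bound (ψ.nbv + j) := by
  simp only [vars, freeVars, plug, Set.mem_ofPred_eq]
  constructor
  · rintro (h | ⟨j, hj, rfl⟩)
    · exact .inl (.inl h)
    · by_cases h : j < ψ.nbv
      · exact .inl (.inr ⟨j, h, rfl⟩)
      · exact .inr ⟨j - ψ.nbv, by omega, by congr; omega⟩
  · rintro ((h | ⟨j, hj, rfl⟩) | ⟨j, hj, rfl⟩)
    · exact .inl h
    · exact .inr ⟨j, by omega, rfl⟩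
    · exact .inr ⟨ψ.nbv + j, by omega, rfl⟩

variable {ψ τ args}

/-- Replacing a predicate call glues the variables of `τ` to those of `ψ` along the parameters. -/
theorem gluing_plug {U : Set SLVar} (hU : U ⊆ ψ.vars) (h0 : SLVar.null ∈ U)
    (hargs : ∀ x ∈ args, x ∈ U) (hlen : τ.nfv = args.length) :
    Gluing ψ.vars U τ.vars τ.freeVars (SLVar.inst args ψ.nbv) where
  subset := hU
  mapsTo := by
    rintro x (rfl | ⟨i, hi, rfl⟩)
    · exact h0
    · rw [hlen] at hi
      simpa [SLVar.inst, hi] using hargs _ (List.getElem_mem hi)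
  mem_of_mem := by
    rintro x (hx | ⟨j, hj, rfl⟩) h
    · exact hx
    · simp [SLVar.inst, vars, freeVars] at h
  inj := by
    rintro x (hx | ⟨j, hj, rfl⟩) y hy hxF he
    · exact absurd hx hxF
    · rcases hy with (rfl | ⟨i, hi, rfl⟩) | ⟨k, hk, rfl⟩
      · simp [SLVar.inst] at he
      · rw [hlen] at hi
        have := hU (hargs _ (List.getElem_mem hi))
        simp only [SLVar.inst, List.getD_eq_getElem _ _ hi] at he
        simp [← he, vars, freeVars] at this
      · simpa [SLVar.inst] using he

theorem inst_mem_vars_plug {x : SLVar} (hx : x ∈ τ.vars) (hargs : ∀ x ∈ args, x ∈ ψ.vars)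
    (hlen : τ.nfv = args.length) : SLVar.inst args ψ.nbv x ∈ (ψ.plug args τ).vars := by
  rw [mem_vars_plug]
  rcases hx with hx | ⟨j, hj, rfl⟩
  · exact .inl ((gluing_plug subset_rfl ψ.null_mem_vars hargs hlen).mapsTo x hx)
  · exact .inr ⟨j, hj, rfl⟩

theorem WellFormed.plug (hψ : ψ.WellFormed) (hτ : τ.WellFormed) (hargs : ∀ x ∈ args, x ∈ ψ.vars)
    (hlen : τ.nfv = args.length) : (ψ.plug args τ).WellFormed := by
  have hl : ∀ x ∈ ψ.vars, x ∈ (ψ.plug args τ).vars := fun x hx =>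
    (mem_vars_plug _ _ _ _).2 (.inl hx)
  have hr : ∀ x ∈ τ.vars, SLVar.inst args ψ.nbv x ∈ (ψ.plug args τ).vars := fun x hx =>
    inst_mem_vars_plug hx hargs hlen
  constructor
  · intro p hp
    rcases List.mem_append.1 hp with hp | hp
    · obtain ⟨h₁, h₂, h₃⟩ := hψ.spatial_mem p hp
      exact ⟨hl _ h₁, h₂, fun y hy => hl _ (h₃ y hy)⟩
    · obtain ⟨q, hq, rfl⟩ := List.mem_map.1 hp
      obtain ⟨h₁, h₂, h₃⟩ := hτ.spatial_mem q hq
      refine ⟨hr _ h₁, by simpa [PointsTo.map] using h₂, fun y hy => ?_⟩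
      obtain ⟨z, hz, rfl⟩ := List.mem_map.1 hy
      exact hr _ (h₃ z hz)
  · intro c hc y hy
    rcases List.mem_append.1 hc with hc | hc
    · exact hl _ (hψ.calls_mem c hc y hy)
    · obtain ⟨d, hd, rfl⟩ := List.mem_map.1 hc
      obtain ⟨z, hz, rfl⟩ := List.mem_map.1 hy
      exact hr _ (hτ.calls_mem d hd z hz)
  · intro x y h
    rcases List.mem_append.1 h with h | h
    · exact (hψ.eq_mem x y h).imp (hl _) (hl _)
    · obtain ⟨π, hπ, he⟩ := List.mem_map.1 h
      cases π with
      | eq a b =>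
        obtain ⟨rfl, rfl⟩ := PureFormula.eq.inj he
        exact (hτ.eq_mem a b hπ).imp (hr _) (hr _)
      | ne a b => cases he
  · intro x y h
    rcases List.mem_append.1 h with h | h
    · exact (hψ.ne_mem x y h).imp (hl _) (hl _)
    · obtain ⟨π, hπ, he⟩ := List.mem_map.1 h
      cases π with
      | ne a b =>
        obtain ⟨rfl, rfl⟩ := PureFormula.ne.inj he
        exact (hτ.ne_mem a b hπ).imp (hr _) (hr _)
      | eq a b => cases he

end SymHeap

/-! ### Compositionality of the constraints -/

namespace SymHeap

/-- Everything that holds in `ψ` about the variables in `U`, or about `ψ` as a whole, also holds in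
`ψ'`. -/
structure Simulates (U : Set SLVar) (ψ ψ' : SymHeap) : Prop where
  eqv : ∀ x ∈ U, ∀ y ∈ U, ψ.Eqv x y → ψ'.Eqv x y
  reach : ∀ x ∈ U, ∀ y ∈ U, ψ.Reach x y → ψ'.Reach x y
  alloc : ∀ x ∈ U, ψ.Alloc x → ψ'.Alloc x
  neq : ∀ x ∈ U, ∀ y ∈ U, ψ.Neq x y → ψ'.Neq x y
  unsat : ψ.Unsat → ψ'.Unsat
  covered : ψ.Covered U → ψ'.Covered U

namespace Simulates

theorem refl (U : Set SLVar) (ψ : SymHeap) : Simulates U ψ ψ :=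
  ⟨fun _ _ _ _ => id, fun _ _ _ _ => id, fun _ _ => id, fun _ _ _ _ => id, id, id⟩

end Simulates

/-- Shrinking the interface: what is reachable from `U` is reachable from `V` as soon as all of
`U` is. -/
theorem Covered.trans {ψ : SymHeap} {U V : Set SLVar} (h : ψ.Covered U)
    (hU : ∀ y ∈ U, ∃ x ∈ V, ψ.Reach x y) : ψ.Covered V := by
  intro y hy
  obtain ⟨x, hx, hxy⟩ := h y hy
  obtain ⟨z, hz, hzx⟩ := hU x hx
  exact ⟨z, hz, EdgePath.trans hzx hxy⟩

theorem Simulates.mono {U V : Set SLVar} {ψ ψ' : SymHeap} (h : Simulates U ψ ψ') (hV : V ⊆ U)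
    (hU : U ⊆ ψ.vars) : Simulates V ψ ψ' where
  eqv x hx y hy := h.eqv x (hV hx) y (hV hy)
  reach x hx y hy := h.reach x (hV hx) y (hV hy)
  alloc x hx := h.alloc x (hV hx)
  neq x hx y hy := h.neq x (hV hx) y (hV hy)
  unsat := h.unsat
  covered hc := by
    refine (h.covered fun y hy => ?_).trans fun y hy => ?_
    · obtain ⟨x, hx, hxy⟩ := hc y hy
      exact ⟨x, hV hx, hxy⟩
    · obtain ⟨x, hx, hxy⟩ := hc y (hU hy)
      exact ⟨x, hx, h.reach x (hV hx) y hy hxy⟩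

section Plug

variable {ψ τ : SymHeap} {args : List SLVar}

theorem Eqv.plug_left {x y : SLVar} (h : ψ.Eqv x y) : (ψ.plug args τ).Eqv x y := by
  rw [Eqv, eqEdges_plug]
  exact EdgePath.glue_left h

theorem Eqv.plug_right {x y : SLVar} (h : τ.Eqv x y) :
    (ψ.plug args τ).Eqv (SLVar.inst args ψ.nbv x) (SLVar.inst args ψ.nbv y) := by
  rw [Eqv, eqEdges_plug]
  exact EdgePath.glue_right h

theorem reach_plug_iff {x y : SLVar} : (ψ.plug args τ).Reach x y ↔
    EdgePath (glue (SLVar.inst args ψ.nbv) ψ.reachEdges τ.reachEdges) x y :=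
  ⟨EdgePath.mono fun e => (reachEdges_plug ψ τ args e).1,
    EdgePath.mono fun e => (reachEdges_plug ψ τ args e).2⟩

theorem inst_eq_of_mem_freeVars {off off' : ℕ} {x : SLVar} (hx : x ∈ τ.freeVars) :
    SLVar.inst args off x = SLVar.inst args off' x := by
  rcases hx with rfl | ⟨i, -, rfl⟩ <;> rfl

theorem Neq.unsat {x y : SLVar} (h : ψ.Neq x y) (he : ψ.Eqv x y) : ψ.Unsat := by
  obtain ⟨e, hm, h₁, h₂⟩ := h
  exact ⟨e, hm, h₁.symm.trans (he.trans h₂)⟩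

theorem Neq.congr {x y x' y' : SLVar} (h : ψ.Neq x y) (hx : ψ.Eqv x' x) (hy : ψ.Eqv y' y) :
    ψ.Neq x' y' := by
  obtain ⟨e, hm, h₁, h₂⟩ := h
  exact ⟨e, hm, hx.trans h₁, hy.trans h₂⟩

theorem Neq.plug_left {x y : SLVar} (h : ψ.Neq x y) : (ψ.plug args τ).Neq x y := by
  obtain ⟨e, hm, h₁, h₂⟩ := h
  exact ⟨e, (mem_neqs_plug _ _ _ _).2 (.inl hm), h₁.plug_left, h₂.plug_left⟩

theorem Neq.plug_right {x y : SLVar} (h : τ.Neq x y) :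
    (ψ.plug args τ).Neq (SLVar.inst args ψ.nbv x) (SLVar.inst args ψ.nbv y) := by
  obtain ⟨e, hm, h₁, h₂⟩ := h
  exact ⟨_, (mem_neqs_plug _ _ _ _).2 (.inr (.inl ⟨e, hm, rfl⟩)), h₁.plug_right, h₂.plug_right⟩

/-- The left-hand sides of points-to assertions of the two parts are different. -/
theorem Alloc.neq_plug {x y : SLVar} (hx : ψ.Alloc x) (hy : τ.Alloc y) :
    (ψ.plug args τ).Neq x (SLVar.inst args ψ.nbv y) := by
  obtain ⟨z, hz, h₁⟩ := hx
  obtain ⟨w, hw, h₂⟩ := hy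
  exact ⟨_, (mem_neqs_plug _ _ _ _).2 (.inr (.inr ⟨z, hz, w, hw, rfl⟩)), h₁.plug_left,
    h₂.plug_right⟩

theorem Alloc.congr {x y : SLVar} (h : ψ.Alloc y) (hx : ψ.Eqv x y) : ψ.Alloc x := by
  obtain ⟨z, hz, h⟩ := h
  exact ⟨z, hz, hx.trans h⟩

theorem Alloc.plug_left {x : SLVar} (h : ψ.Alloc x) : (ψ.plug args τ).Alloc x := by
  obtain ⟨z, hz, h⟩ := h
  exact ⟨z, by simp [sources_plug, hz], h.plug_left⟩

theorem Alloc.plug_right {x : SLVar} (h : τ.Alloc x) :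
    (ψ.plug args τ).Alloc (SLVar.inst args ψ.nbv x) := by
  obtain ⟨z, hz, h⟩ := h
  refine ⟨_, ?_, h.plug_right⟩
  rw [sources_plug]
  exact List.mem_append_right _ (List.mem_map_of_mem hz)

end Plug

/-- Replacing a predicate call preserves simulation: every property of the glued heap is assembled
from properties of its two parts along the interface. -/
theorem Simulates.plug {U : Set SLVar} {ψ ψ' τ τ' : SymHeap} {args : List SLVar}
    (S : Simulates U ψ ψ') (T : Simulates τ.freeVars τ τ') (hψ : ψ.WellFormed)
    (hτ : τ.WellFormed) (hU : U ⊆ ψ.vars) (h0 : SLVar.null ∈ U) (hargs : ∀ x ∈ args, x ∈ U)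
    (hlen : τ.nfv = args.length) :
    Simulates U (ψ.plug args τ) (ψ'.plug args τ') := by
  have g := gluing_plug hU h0 hargs hlen
  have he₁ := hψ.edgesIn_eqEdges
  have he₂ := hτ.edgesIn_eqEdges
  have hr₁ := hψ.edgesIn_reachEdges
  have hr₂ := hτ.edgesIn_reachEdges
  set f := SLVar.inst args ψ.nbv with hf
  set f' := SLVar.inst args ψ'.nbv with hf'
  have hff : ∀ x ∈ τ.freeVars, f x = f' x := fun x hx => inst_eq_of_mem_freeVars hx
  have eqv_iff : ∀ {x y}, (ψ.plug args τ).Eqv x y ↔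
      EdgePath (glue f ψ.eqEdges τ.eqEdges) x y := by
    intro x y
    rw [Eqv, eqEdges_plug]
  -- Shortcuts of the first heap are paths of the second.
  have heq : ∀ {x y}, Relation.ReflTransGen (Shortcut U τ.freeVars f ψ.eqEdges τ.eqEdges) x y →
      (ψ'.plug args τ').Eqv x y := by
    intro x y h
    rw [Eqv, eqEdges_plug]
    exact EdgePath.of_shortcuts hff S.eqv T.eqv h
  have hreach : ∀ {x y},
      Relation.ReflTransGen (Shortcut U τ.freeVars f ψ.reachEdges τ.reachEdges) x y →
      (ψ'.plug args τ').Reach x y := by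
    intro x y h
    rw [reach_plug_iff]
    exact EdgePath.of_shortcuts hff S.reach T.reach h
  have hS : ∀ x ∈ U, ∀ y ∈ U, ψ.Neq x y → (ψ'.plug args τ').Neq x y := fun x hx y hy h =>
    (S.neq x hx y hy h).plug_left
  have hT : ∀ x ∈ τ.freeVars, ∀ y ∈ τ.freeVars, τ.Neq x y →
      (ψ'.plug args τ').Neq (f x) (f y) := by
    intro x hx y hy h
    rw [hff x hx, hff y hy]
    exact (T.neq x hx y hy h).plug_right
  have hST : ∀ x ∈ U, ∀ y ∈ τ.freeVars, ψ.Alloc x → τ.Alloc y →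
      (ψ'.plug args τ').Neq x (f y) := by
    intro x hx y hy h₁ h₂
    rw [hff y hy]
    exact (S.alloc x hx h₁).neq_plug (T.alloc y hy h₂)
  refine ⟨?_, ?_, ?_, ?_, ?_, ?_⟩
  · intro x hx y hy h
    obtain ⟨v, hv, hs, hp⟩ := g.path_left he₁ he₂ hx (hU hy) (eqv_iff.1 h)
    exact (heq hs).trans (S.eqv v hv y hy hp).plug_left
  · intro x hx y hy h
    obtain ⟨v, hv, hs, hp⟩ := g.path_left hr₁ hr₂ hx (hU hy) (reach_plug_iff.1 h)
    exact (hreach hs).trans (reach_plug_iff.2 (EdgePath.glue_left (S.reach v hv y hy hp)))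
  · rintro x hx ⟨z, hz, h⟩
    rw [sources_plug, List.mem_append] at hz
    rcases hz with hz | hz
    · obtain ⟨v, hv, hs, hp⟩ := g.path_left he₁ he₂ hx (hψ.sources_mem hz) (eqv_iff.1 h)
      exact (S.alloc v hv ⟨z, hz, hp⟩).plug_left.congr (heq hs)
    · obtain ⟨w, hw, rfl⟩ := List.mem_map.1 hz
      obtain ⟨u, hu, hs, hp⟩ := g.path_right he₁ he₂ hx (hτ.sources_mem hw) (eqv_iff.1 h)
      have hs := heq hs
      rw [hff u hu] at hs
      exact (T.alloc u hu ⟨w, hw, hp⟩).plug_right.congr hs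
  · rintro x hx y hy ⟨e, he, h₁, h₂⟩
    rw [eqv_iff] at h₁ h₂
    rcases (mem_neqs_plug _ _ _ _).1 he with he | ⟨d, hd, rfl⟩ | ⟨a, ha, b, hb, rfl⟩
    · have hm := hψ.edgesIn_neqs e he
      obtain ⟨v, hv, hs, hp⟩ := g.path_left he₁ he₂ hx hm.1 h₁
      obtain ⟨w, hw, hs', hp'⟩ := g.path_left he₁ he₂ hy hm.2 h₂
      exact (hS v hv w hw ⟨e, he, hp, hp'⟩).congr (heq hs) (heq hs')
    · have hm := hτ.edgesIn_neqs d hd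
      obtain ⟨v, hv, hs, hp⟩ := g.path_right he₁ he₂ hx hm.1 h₁
      obtain ⟨w, hw, hs', hp'⟩ := g.path_right he₁ he₂ hy hm.2 h₂
      exact (hT v hv w hw ⟨d, hd, hp, hp'⟩).congr (heq hs) (heq hs')
    · obtain ⟨v, hv, hs, hp⟩ := g.path_left he₁ he₂ hx (hψ.sources_mem ha) h₁
      obtain ⟨w, hw, hs', hp'⟩ := g.path_right he₁ he₂ hy (hτ.sources_mem hb) h₂
      exact (hST v hv w hw ⟨a, ha, hp⟩ ⟨b, hb, hp'⟩).congr (heq hs) (heq hs')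
  · rintro ⟨e, he, h⟩
    rw [eqv_iff] at h
    rcases (mem_neqs_plug _ _ _ _).1 he with he | ⟨d, hd, rfl⟩ | ⟨a, ha, b, hb, rfl⟩
    · have hm := hψ.edgesIn_neqs e he
      rcases g.path_left_left he₁ he₂ hm.1 hm.2 h with hp | ⟨v, hv, w, hw, hp, hs, hp'⟩
      · obtain ⟨d, hd, hdd⟩ := S.unsat ⟨e, he, hp⟩
        exact ⟨d, (mem_neqs_plug _ _ _ _).2 (.inl hd), hdd.plug_left⟩
      · exact (hS v hv w hw ⟨e, he, Eqv.symm hp, hp'⟩).unsat (heq hs)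
    · have hm := hτ.edgesIn_neqs d hd
      rcases g.path_right_right he₁ he₂ hm.1 hm.2 h with hp | ⟨v, hv, w, hw, hp, hs, hp'⟩
      · obtain ⟨d, hd, hdd⟩ := T.unsat ⟨d, hd, hp⟩
        exact ⟨_, (mem_neqs_plug _ _ _ _).2 (.inr (.inl ⟨d, hd, rfl⟩)), hdd.plug_right⟩
      · exact (hT v hv w hw ⟨d, hd, Eqv.symm hp, hp'⟩).unsat (heq hs)
    · obtain ⟨v, hv, w, hw, hp, hs, hp'⟩ :=
        g.path_left_right he₁ he₂ (hψ.sources_mem ha) (hτ.sources_mem hb) h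
      exact (hST v hv w hw ⟨a, ha, Eqv.symm hp⟩ ⟨b, hb, hp'⟩).unsat (heq hs)
  · intro hc
    have hcψ : ψ.Covered U := by
      intro y hy
      obtain ⟨x, hx, hxy⟩ := hc y ((mem_vars_plug _ _ _ _).2 (.inl hy))
      obtain ⟨v, hv, -, hp⟩ := g.path_left hr₁ hr₂ hx hy (reach_plug_iff.1 hxy)
      exact ⟨v, hv, hp⟩
    have hcτ : τ.Covered τ.freeVars := by
      intro y hy
      obtain ⟨x, hx, hxy⟩ := hc (f y) (inst_mem_vars_plug hy (fun x hx => hU (hargs x hx)) hlen)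
      obtain ⟨u, hu, -, hp⟩ := g.path_right hr₁ hr₂ hx hy (reach_plug_iff.1 hxy)
      exact ⟨u, hu, hp⟩
    intro y hy
    rcases (mem_vars_plug _ _ _ _).1 hy with hy | ⟨j, hj, rfl⟩
    · obtain ⟨x, hx, hxy⟩ := S.covered hcψ y hy
      exact ⟨x, hx, reach_plug_iff.2 (EdgePath.glue_left hxy)⟩
    · obtain ⟨x, hx, hxy⟩ := T.covered hcτ (.bound j) (.inr ⟨j, hj, rfl⟩)
      exact ⟨f x, g.mapsTo x hx, hff x hx ▸ reach_plug_iff.2 (EdgePath.glue_right hxy)⟩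

/-- The heaps `τs` can be substituted for the predicate calls `cs`. -/
def Substitutable (cs : List PredCall) (τs : List SymHeap) : Prop :=
  List.Forall₂ (fun c τ => τ.WellFormed ∧ τ.calls = [] ∧ τ.nfv = c.args.length) cs τs

/-- The replacement of several predicate calls, one after the other. -/
def plugAll (ψ : SymHeap) (cτs : List (PredCall × SymHeap)) : SymHeap :=
  cτs.foldl (fun ψ cτ => ψ.plug cτ.1.args cτ.2) ψ

theorem vars_subset_vars_plug (ψ : SymHeap) (args : List SLVar) (τ : SymHeap) :
    ψ.vars ⊆ (ψ.plug args τ).vars := fun _ hx => (mem_vars_plug _ _ _ _).2 (.inl hx)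

theorem plugAll_wellFormed {cs : List PredCall} {τs : List SymHeap} (h : Substitutable cs τs)
    {ψ : SymHeap} (hψ : ψ.WellFormed) (hc : ψ.calls = [])
    (hargs : ∀ c ∈ cs, ∀ x ∈ c.args, x ∈ ψ.vars) :
    (plugAll ψ (cs.zip τs)).WellFormed ∧ (plugAll ψ (cs.zip τs)).calls = [] ∧
      (plugAll ψ (cs.zip τs)).nfv = ψ.nfv ∧ ψ.vars ⊆ (plugAll ψ (cs.zip τs)).vars := by
  induction h generalizing ψ with
  | nil => exact ⟨hψ, hc, rfl, subset_rfl⟩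
  | @cons c τ cs τs hcτ _ ih =>
    obtain ⟨hτ, hτc, hlen⟩ := hcτ
    have hsub := vars_subset_vars_plug ψ c.args τ
    obtain ⟨h₁, h₂, h₃, h₄⟩ := ih (hψ.plug hτ (hargs c (by simp)) hlen)
      (by simp [SymHeap.plug, hc, hτc])
      (fun d hd x hx => hsub (hargs d (List.mem_cons_of_mem _ hd) x hx))
    exact ⟨h₁, h₂, h₃, hsub.trans h₄⟩

theorem Simulates.plugAll {U : Set SLVar} (h0 : SLVar.null ∈ U) {cs : List PredCall}
    {τs τs' : List SymHeap} (h : Substitutable cs τs)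
    (T : List.Forall₂ (fun τ τ' => Simulates τ.freeVars τ τ') τs τs') {ψ ψ' : SymHeap}
    (S : Simulates U ψ ψ') (hψ : ψ.WellFormed) (hU : U ⊆ ψ.vars)
    (hargs : ∀ c ∈ cs, ∀ x ∈ c.args, x ∈ U) :
    Simulates U (SymHeap.plugAll ψ (cs.zip τs)) (SymHeap.plugAll ψ' (cs.zip τs')) := by
  induction h generalizing ψ ψ' τs' with
  | nil => exact S
  | @cons c τ cs τs hcτ _ ih =>
    obtain ⟨hτ, -, hlen⟩ := hcτ
    obtain _ | ⟨hT, T⟩ := T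
    have hc := hargs c (by simp)
    exact ih T (S.plug hT hψ hτ hU h0 hc hlen) (hψ.plug hτ (fun x hx => hU (hc x hx)) hlen)
      (hU.trans (vars_subset_vars_plug _ _ _)) (fun d hd => hargs d (List.mem_cons_of_mem _ hd))

theorem WellFormed.forget_calls {φ : SymHeap} (h : φ.WellFormed) :
    WellFormed { φ with calls := [] } :=
  ⟨h.spatial_mem, by simp, h.eq_mem, h.ne_mem⟩

theorem replace_wellFormed {φ : SymHeap} (hφ : φ.WellFormed) {τs : List SymHeap}
    (h : Substitutable φ.calls τs) : (φ.replace τs).WellFormed ∧ (φ.replace τs).calls = [] ∧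
      (φ.replace τs).nfv = φ.nfv ∧ φ.vars ⊆ (φ.replace τs).vars :=
  plugAll_wellFormed h hφ.forget_calls rfl hφ.calls_mem

theorem Simulates.replace {φ : SymHeap} (hφ : φ.WellFormed) {τs τs' : List SymHeap}
    (h : Substitutable φ.calls τs)
    (T : List.Forall₂ (fun τ τ' => Simulates τ.freeVars τ τ') τs τs') :
    Simulates φ.freeVars (φ.replace τs) (φ.replace τs') :=
  Simulates.mono
    (Simulates.plugAll φ.null_mem_vars h T (Simulates.refl _ _) hφ.forget_calls subset_rfl
      hφ.calls_mem)
    φ.freeVars_subset_vars (replace_wellFormed hφ h).2.2.2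

end SymHeap

/-! ### Definite relationships in terms of the constraints -/

theorem nodup_map_iff_orderedPairs {V : Type*} (s : V → ℕ) (l : List V) :
    (l.map s).Nodup ↔ ∀ e ∈ orderedPairs l, s e.1 ≠ s e.2 := by
  induction l with
  | nil => simp
  | cons a l ih =>
    simp only [List.map_cons, List.nodup_cons, ih, orderedPairs_cons, List.mem_append, or_imp,
      forall_and, List.mem_map, not_exists, not_and]
    refine and_congr_left fun _ => ⟨?_, fun h b hb he => h (a, b) ⟨b, hb, rfl⟩ he.symm⟩
    rintro h _ ⟨b, hb, rfl⟩ he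
    exact h b hb he.symm

/-- In a model of a separating conjunction of points-to assertions, the left-hand sides are the
distinct locations of the heap. -/
theorem SpatialSat.cells {s : SLVar → ℕ} {ps : List PointsTo} {h : SLHeap}
    (H : SpatialSat s ps h) :
    (ps.map fun p => s p.src).Nodup ∧ (∀ p ∈ ps, h.cells (s p.src) = some (p.tgt.map s)) ∧
      ∀ l, h.cells l ≠ none → ∃ p ∈ ps, s p.src = l := by
  induction ps generalizing h with
  | nil => exact ⟨by simp, by simp, fun l hl => absurd (H l) hl⟩
  | cons p ps ih =>
    obtain ⟨h₁, h₂, hu, ⟨hp, hp'⟩, H₂⟩ := H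
    obtain ⟨hn, hc, hd⟩ := ih H₂
    have h2 : h₂.cells (s p.src) = none := by
      rcases hu (s p.src) with ⟨h, -⟩ | ⟨h, -⟩
      · simp [hp] at h
      · exact h
    have h1 : ∀ q ∈ ps, s q.src ≠ s p.src := by
      intro q hq he
      have := hc q hq
      simp [he, h2] at this
    refine ⟨?_, ?_, ?_⟩
    · simp only [List.map_cons, List.nodup_cons, hn, and_true, List.mem_map, not_exists, not_and]
      exact h1
    · intro q hq
      rcases List.mem_cons.1 hq with rfl | hq
      · rcases hu (s q.src) with ⟨h, -⟩ | ⟨-, h⟩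
        · simp [hp] at h
        · rw [h, hp]
      · rcases hu (s q.src) with ⟨-, h⟩ | ⟨h, -⟩
        · rw [h, hc q hq]
        · simp [hc q hq] at h
    · intro l hl
      by_cases he : s p.src = l
      · exact ⟨p, by simp, he⟩
      · have : h₂.cells l ≠ none := by
          rcases hu l with ⟨-, h⟩ | ⟨-, h⟩
          · rwa [← h]
          · rw [h, hp' l (Ne.symm he)] at hl
            exact absurd rfl hl
        obtain ⟨q, hq, he⟩ := hd l this
        exact ⟨q, List.mem_cons_of_mem _ hq, he⟩

/-- A stack under which the left-hand sides are distinct and non-null extends to a model of the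
separating conjunction. -/
theorem SpatialSat.exists {s : SLVar → ℕ} {ps : List PointsTo}
    (hn : (ps.map fun p => s p.src).Nodup) (h0 : ∀ p ∈ ps, s p.src ≠ 0) :
    ∃ h, SpatialSat s ps h := by
  induction ps with
  | nil => exact ⟨⟨fun _ => none, rfl, by simp⟩, fun _ => rfl⟩
  | cons p ps ih =>
    rw [List.map_cons, List.nodup_cons] at hn
    obtain ⟨h₂, H₂⟩ := ih hn.2 fun q hq => h0 q (List.mem_cons_of_mem _ hq)
    have hp0 := h0 p (by simp)
    have h2 : h₂.cells (s p.src) = none := by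
      by_contra hne
      obtain ⟨q, hq, he⟩ := H₂.cells.2.2 _ hne
      exact hn.1 (List.mem_map.2 ⟨q, hq, he⟩)
    classical
    let h₁ : SLHeap := ⟨fun l => if l = s p.src then some (p.tgt.map s) else none,
      by simp [hp0.symm], (Set.finite_singleton (s p.src)).subset fun l hl => by
        by_contra hne
        exact hl (if_neg hne)⟩
    let h : SLHeap := ⟨fun l => if l = s p.src then some (p.tgt.map s) else h₂.cells l,
      by simp [hp0.symm, h₂.cells_null],
      ((Set.finite_singleton (s p.src)).union h₂.finite_dom).subset fun l hl => by
        by_cases he : l = s p.src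
        · exact .inl he
        · refine .inr fun hl' => hl ?_
          simpa [he] using hl'⟩
    refine ⟨h, h₁, h₂, fun l => ?_, ⟨?_, fun l hl => ?_⟩, H₂⟩
    · by_cases he : l = s p.src
      · subst he
        exact .inr ⟨h2, by simp [h, h₁]⟩
      · exact .inl ⟨by simp [h₁, he], by simp [h, he]⟩
    · simp [h₁]
    · simp [h₁, hl]

namespace SymHeap

variable {τ : SymHeap}

/-- Derivable equalities hold in every model. -/
theorem Eqv.defEq {x y : SLVar} (h : τ.Eqv x y) : τ.DefEq x y := by
  intro s hp hm
  induction h with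
  | refl => rfl
  | tail _ he ih =>
    obtain ⟨π, hπ, he⟩ := List.mem_flatMap.1 he
    have := hm.2.2 π hπ
    cases π with
    | eq a b =>
      simp only [PureFormula.eqEdges, List.mem_cons, List.not_mem_nil, or_false,
        Prod.mk.injEq] at he
      simp only [PureFormula.Sat] at this
      rcases he with ⟨rfl, rfl⟩ | ⟨rfl, rfl⟩ <;> simp [ih, this]
    | ne a b => simp [PureFormula.eqEdges] at he

/-- Derivable inequalities hold in every model. -/
theorem BodyModel.ne {s : SLVar → ℕ} {h : SLHeap} (hm : τ.BodyModel s h) {e : SLVar × SLVar}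
    (he : e ∈ τ.neqs) : s e.1 ≠ s e.2 := by
  obtain ⟨hn, hc, -⟩ := hm.2.1.cells
  rcases List.mem_append.1 he with he | he
  · obtain ⟨π, hπ, he⟩ := List.mem_flatMap.1 he
    have := hm.2.2 π hπ
    cases π with
    | eq x y => simp [PureFormula.neqs] at he
    | ne x y =>
      obtain rfl : e = (x, y) := by simpa [PureFormula.neqs] using he
      exact this
  rcases List.mem_append.1 he with he | he
  · obtain ⟨x, hx, rfl⟩ := List.mem_map.1 he
    obtain ⟨p, hp, rfl⟩ := List.mem_map.1 hx
    intro h0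
    have := hc p hp
    simp [show s p.src = 0 from h0.trans hm.1, h.cells_null] at this
  · refine (nodup_map_iff_orderedPairs s τ.sources).1 ?_ e he
    simpa [sources, Function.comp_def] using hn

theorem Unsat.not_bodyModel (hu : τ.Unsat) (s : SLVar → ℕ) (h : SLHeap) : ¬ τ.BodyModel s h := by
  obtain ⟨e, he, hee⟩ := hu
  exact fun hm => hm.ne he (hee.defEq s h hm)

/-- If the constraints are consistent, they have a generic model, in which variables are equal only
if this is derivable. -/
theorem exists_generic_model (hu : ¬ τ.Unsat) :
    ∃ s h, τ.BodyModel s h ∧ ∀ x y, s x = s y ↔ τ.Eqv x y := by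
  classical
  let S : Setoid SLVar := ⟨τ.Eqv, ⟨fun x => EdgePath.refl _ x, Eqv.symm, Eqv.trans⟩⟩
  let r : SLVar → SLVar := fun x => (Quotient.mk S x).out
  have hr : ∀ x y, r x = r y ↔ τ.Eqv x y := fun x y =>
    Quotient.out_injective.eq_iff.trans Quotient.eq
  -- The class of `null` has to be sent to `0`, all others to pairwise distinct locations.
  let s : SLVar → ℕ := fun x => if r x = r .null then 0 else Encodable.encode (r x) + 1
  have hs : ∀ x y, s x = s y ↔ τ.Eqv x y := by
    intro x y
    rw [← hr]
    by_cases hx : r x = r .null <;> by_cases hy : r y = r .null <;> simp [s, hx, hy]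
    · exact fun h => hy h.symm
  have hs0 : s .null = 0 := by simp [s]
  have hne : ∀ e ∈ τ.neqs, s e.1 ≠ s e.2 := fun e he h => hu ⟨e, he, (hs _ _).1 h⟩
  obtain ⟨h, hh⟩ : ∃ h, SpatialSat s τ.spatial h := by
    refine SpatialSat.exists ?_ ?_
    · have : (τ.sources.map s).Nodup := by
        refine (nodup_map_iff_orderedPairs s τ.sources).2 fun e he => hne e ?_
        simp [neqs, he]
      simpa [sources, Function.comp_def] using this
    · intro p hp
      have := hne (p.src, .null) (List.mem_append_right _ (List.mem_append_left _
        (List.mem_map.2 ⟨_, List.mem_map_of_mem hp, rfl⟩)))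
      rwa [← hs0]
  refine ⟨s, h, ⟨hs0, hh, fun π hπ => ?_⟩, hs⟩
  cases π with
  | eq x y =>
    refine (hs x y).2 (EdgePath.single (List.mem_flatMap.2 ⟨_, hπ, ?_⟩))
    simp [PureFormula.eqEdges]
  | ne x y =>
    refine hne (x, y) (List.mem_append_left _ (List.mem_flatMap.2 ⟨_, hπ, ?_⟩))
    simp [PureFormula.neqs]

theorem Eqv.reach {x y : SLVar} (h : τ.Eqv x y) : τ.Reach x y :=
  EdgePath.mono (List.subset_append_left _ _) h

theorem DefPointsTo.reach (hu : ¬ τ.Unsat) {x y : SLVar} (h : τ.DefPointsTo x y) :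
    τ.Reach x y := by
  obtain ⟨s, hp, hm, hs⟩ := exists_generic_model hu
  obtain ⟨v, hv, hy⟩ := h s hp hm
  obtain ⟨-, hc, hd⟩ := hm.2.1.cells
  obtain ⟨p, hpm, he⟩ := hd (s x) (by simp [hv])
  have hcp := hc p hpm
  rw [he, hv] at hcp
  obtain rfl := Option.some.inj hcp
  obtain ⟨t, ht, hty⟩ := List.mem_map.1 hy
  have hedge : τ.Reach p.src t := EdgePath.single (List.mem_append_right _
    (List.mem_flatMap.2 ⟨p, hpm, List.mem_map_of_mem ht⟩))
  exact (((hs _ _).1 he).symm.reach.trans hedge).trans ((hs _ _).1 hty).reach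

theorem DefReach.reach (hu : ¬ τ.Unsat) {x y : SLVar} (h : τ.DefReach x y) : τ.Reach x y := by
  induction h with
  | single h => exact h.reach hu
  | step _ h _ ih => exact (h.reach hu).trans ih

theorem DefPointsTo.congr {x x' y y' : SLVar} (h : τ.DefPointsTo x y) (hx : τ.DefEq x' x)
    (hy : τ.DefEq y y') : τ.DefPointsTo x' y' := by
  intro s hp hm
  rw [hx s hp hm, ← hy s hp hm]
  exact h s hp hm

theorem DefReach.congr {x x' y : SLVar} (h : τ.DefReach x y) (hx : τ.DefEq x' x) :
    τ.DefReach x' y := by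
  cases h with
  | single h => exact .single (h.congr hx fun _ _ _ => rfl)
  | step hz h h' => exact .step hz (h.congr hx fun _ _ _ => rfl) h'

theorem Reach.defEq_or_defReach (hτ : τ.WellFormed) {x y : SLVar} (h : τ.Reach x y) :
    τ.DefEq x y ∨ τ.DefReach x y := by
  induction h using Relation.ReflTransGen.head_induction_on with
  | refl => exact .inl fun _ _ _ => rfl
  | @head a c he _ ih =>
    rcases List.mem_append.1 he with he | he
    · have hac : τ.DefEq a c := Eqv.defEq (EdgePath.single he)
      rcases ih with ih | ih
      · exact .inl fun s h hm => (hac s h hm).trans (ih s h hm)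
      · exact .inr (ih.congr hac)
    · obtain ⟨p, hp, he⟩ := List.mem_flatMap.1 he
      obtain ⟨t, ht, he⟩ := List.mem_map.1 he
      obtain ⟨rfl, rfl⟩ := Prod.mk.inj he
      have hpt : τ.DefPointsTo p.src t := fun s h hm =>
        ⟨_, hm.2.1.cells.2.1 p hp, List.mem_map_of_mem ht⟩
      rcases ih with ih | ih
      · exact .inr (.single (hpt.congr (fun _ _ _ => rfl) ih))
      · exact .inr (.step ((hτ.spatial_mem p hp).2.2 t ht) hpt ih)

/-- Without models every definite relationship holds; otherwise, the definite relationships are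
those which hold in a generic model. -/
theorem garbageFree_iff (hτ : τ.WellFormed) :
    τ.GarbageFree ↔ τ.Unsat ∨ τ.Covered τ.freeVars := by
  by_cases hu : τ.Unsat
  · simp only [hu, true_or, iff_true]
    exact fun y _ => ⟨.null, τ.null_mem_freeVars, .inl fun s h hm => absurd hm
      (hu.not_bodyModel s h)⟩
  · simp only [hu, false_or]
    refine ⟨fun hg y hy => ?_, fun hc y hy => ?_⟩
    · obtain ⟨x, hx, h | h⟩ := hg y hy
      · obtain ⟨s, hp, hm, hs⟩ := exists_generic_model hu
        exact ⟨x, hx, ((hs x y).1 (h s hp hm)).reach⟩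
      · exact ⟨x, hx, h.reach hu⟩
    · obtain ⟨x, hx, h⟩ := hc y hy
      exact ⟨x, hx, h.defEq_or_defReach hτ⟩

end SymHeap

/-! ### Primitive recursive operations on symbolic heaps -/

namespace Primrec

variable {α β σ : Type*} [Primcodable α] [Primcodable β] [Primcodable σ]

theorem list_zip : Primrec fun p : List α × List β => p.1.zip p.2 := by
  have h : Primrec fun p : List α × List β => (List.range p.1.length).filterMap fun i =>
      p.1[i]?.bind fun a => p.2[i]?.map fun b => (a, b) := by
    refine listFilterMap (list_range.comp (list_length.comp fst)) ?_
    refine option_bind (list_getElem?.comp (fst.comp fst) snd) ?_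
    exact option_map (list_getElem?.comp (snd.comp (fst.comp fst)) (snd.comp fst))
      (pair (snd.comp fst) snd)
  refine h.of_eq fun ⟨l₁, l₂⟩ => ?_
  induction l₁ generalizing l₂ with
  | nil => rfl
  | cons a l ih =>
    cases l₂ with
    | nil => simp
    | cons b l₂ =>
      simp [List.range_succ_eq_map, List.filterMap_map, ← ih l₂]

theorem slVar_free : Primrec SLVar.free :=
  (of_equiv_symm (e := SLVar.equivCode)).comp (option_some.comp sumInl)

theorem slVar_bound : Primrec SLVar.bound :=
  (of_equiv_symm (e := SLVar.equivCode)).comp (option_some.comp sumInr)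

theorem slVar_inst {f : α → List SLVar} {g : α → ℕ} {h : α → SLVar} (hf : Primrec f)
    (hg : Primrec g) (hh : Primrec h) : Primrec fun a => SLVar.inst (f a) (g a) (h a) := by
  refine (option_casesOn ((of_equiv (e := SLVar.equivCode)).comp hh) (const SLVar.null)
    (sumCasesOn (g := fun p i => (f p.1).getD i SLVar.null)
      (h := fun p j => SLVar.bound (g p.1 + j)) snd ?_ ?_).to₂).of_eq fun a => ?_
  · exact (list_getD _).comp (hf.comp (fst.comp fst)) snd
  · exact slVar_bound.comp (nat_add.comp (hg.comp (fst.comp fst)) snd)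
  · cases h a <;> rfl

theorem pointsTo_src : Primrec PointsTo.src :=
  fst.comp (of_equiv (e := PointsTo.equivCode))

theorem pointsTo_tgt : Primrec PointsTo.tgt :=
  snd.comp (of_equiv (e := PointsTo.equivCode))

theorem predCall_args : Primrec PredCall.args :=
  snd.comp (of_equiv (e := PredCall.equivCode))

theorem pointsTo_map {f : α → SLVar → SLVar} {g : α → PointsTo} (hf : Primrec₂ f)
    (hg : Primrec g) : Primrec fun a => (g a).map (f a) :=
  ((of_equiv_symm (e := PointsTo.equivCode)).comp
    (pair (hf.comp .id (pointsTo_src.comp hg)) (list_map (pointsTo_tgt.comp hg) hf)))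

theorem predCall_map {f : α → SLVar → SLVar} {g : α → PredCall} (hf : Primrec₂ f)
    (hg : Primrec g) : Primrec fun a => (g a).map (f a) :=
  ((of_equiv_symm (e := PredCall.equivCode)).comp
    (pair (fst.comp ((of_equiv (e := PredCall.equivCode)).comp hg))
      (list_map (predCall_args.comp hg) hf)))

/-- Case distinction on pure formulas. -/
theorem pureFormula_casesOn {f : α → PureFormula} {g h : α → SLVar × SLVar → σ} (hf : Primrec f)
    (hg : Primrec₂ g) (hh : Primrec₂ h) :
    @Primrec _ σ _ _ fun a => PureFormula.casesOn (f a) (fun x y => g a (x, y))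
      (fun x y => h a (x, y)) :=
  (sumCasesOn ((of_equiv (e := PureFormula.equivCode)).comp hf) hg hh).of_eq fun a => by
    cases f a <;> rfl

theorem pureFormula_map {f : α → SLVar → SLVar} {g : α → PureFormula} (hf : Primrec₂ f)
    (hg : Primrec g) : Primrec fun a => (g a).map (f a) := by
  have hp : Primrec fun p : α × SLVar × SLVar => (f p.1 p.2.1, f p.1 p.2.2) :=
    pair (hf.comp fst (fst.comp snd)) (hf.comp fst (snd.comp snd))
  have h := of_equiv_symm (e := PureFormula.equivCode)
  refine (pureFormula_casesOn (g := fun a p => PureFormula.eq (f a p.1) (f a p.2))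
    (h := fun a p => PureFormula.ne (f a p.1) (f a p.2)) hg ?_ ?_).of_eq fun a => ?_
  · exact h.comp (sumInl.comp hp)
  · exact h.comp (sumInr.comp hp)
  · cases g a <;> rfl

theorem pureFormula_eqEdges : Primrec PureFormula.eqEdges := by
  refine (pureFormula_casesOn (g := fun _ p => [(p.1, p.2), (p.2, p.1)]) (h := fun _ _ => [])
    .id ?_ (const [])).of_eq fun π => by cases π <;> rfl
  exact list_cons.comp (pair (fst.comp snd) (snd.comp snd))
    (list_cons.comp (pair (snd.comp snd) (fst.comp snd)) (const []))

theorem pureFormula_neqs : Primrec PureFormula.neqs := by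
  refine (pureFormula_casesOn (g := fun _ _ => []) (h := fun _ p => [(p.1, p.2)])
    .id (const []) ?_).of_eq fun π => by cases π <;> rfl
  exact list_cons.comp (pair (fst.comp snd) (snd.comp snd)) (const [])

theorem symHeap_nfv : Primrec SymHeap.nfv :=
  fst.comp (of_equiv (e := SymHeap.equivCode))

theorem symHeap_nbv : Primrec SymHeap.nbv :=
  (fst.comp snd).comp (of_equiv (e := SymHeap.equivCode))

theorem symHeap_spatial : Primrec SymHeap.spatial :=
  (fst.comp (snd.comp snd)).comp (of_equiv (e := SymHeap.equivCode))

theorem symHeap_calls : Primrec SymHeap.calls :=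
  (fst.comp (snd.comp (snd.comp snd))).comp (of_equiv (e := SymHeap.equivCode))

theorem symHeap_pures : Primrec SymHeap.pures :=
  (snd.comp (snd.comp (snd.comp snd))).comp (of_equiv (e := SymHeap.equivCode))

theorem symHeap_mk {n m : α → ℕ} {s : α → List PointsTo} {c : α → List PredCall}
    {p : α → List PureFormula} (hn : Primrec n) (hm : Primrec m) (hs : Primrec s)
    (hc : Primrec c) (hp : Primrec p) :
    Primrec fun a => (⟨n a, m a, s a, c a, p a⟩ : SymHeap) :=
  (of_equiv_symm (e := SymHeap.equivCode)).comp (pair hn (pair hm (pair hs (pair hc hp))))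

theorem symHeap_plug {f : α → SymHeap} {g : α → List SLVar} {h : α → SymHeap} (hf : Primrec f)
    (hg : Primrec g) (hh : Primrec h) : Primrec fun a => (f a).plug (g a) (h a) := by
  have hi {γ : Type} [Primcodable γ] :
      Primrec₂ fun (p : α × γ) x => SLVar.inst (g p.1) (f p.1).nbv x :=
    slVar_inst (hg.comp (fst.comp fst)) (symHeap_nbv.comp (hf.comp (fst.comp fst))) snd
  exact symHeap_mk (symHeap_nfv.comp hf) (nat_add.comp (symHeap_nbv.comp hf) (symHeap_nbv.comp hh))
    (list_append.comp (symHeap_spatial.comp hf)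
      (list_map (symHeap_spatial.comp hh) (pointsTo_map hi snd)))
    (list_append.comp (symHeap_calls.comp hf)
      (list_map (symHeap_calls.comp hh) (predCall_map hi snd)))
    (list_append.comp (symHeap_pures.comp hf)
      (list_map (symHeap_pures.comp hh) (pureFormula_map hi snd)))

theorem symHeap_replace {f : α → SymHeap} {g : α → List SymHeap} (hf : Primrec f)
    (hg : Primrec g) : Primrec fun a => (f a).replace (g a) := by
  refine list_foldl (list_zip.comp (pair (symHeap_calls.comp hf) hg))
    (symHeap_mk (symHeap_nfv.comp hf) (symHeap_nbv.comp hf) (symHeap_spatial.comp hf)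
      (const []) (symHeap_pures.comp hf))
    (h := fun _ p => p.1.plug p.2.1.args p.2.2) ?_
  exact symHeap_plug (fst.comp snd) (predCall_args.comp (fst.comp (snd.comp snd)))
    (snd.comp (snd.comp snd))

theorem list_orderedPairs : Primrec (orderedPairs (V := α)) :=
  list_rec (h := fun _ p => p.2.1.map (Prod.mk p.1) ++ p.2.2) .id (const [])
    (list_append.comp
      (list_map (fst.comp (snd.comp snd)) (pair (fst.comp (snd.comp fst)) snd))
      (snd.comp (snd.comp snd)))

theorem symHeap_eqEdges : Primrec SymHeap.eqEdges :=
  list_flatMap symHeap_pures (pureFormula_eqEdges.comp snd)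

theorem symHeap_reachEdges : Primrec SymHeap.reachEdges :=
  list_append.comp symHeap_eqEdges (list_flatMap symHeap_spatial
    (list_map (pointsTo_tgt.comp snd) (pair (pointsTo_src.comp (snd.comp fst)) snd)))

theorem symHeap_sources : Primrec SymHeap.sources :=
  list_map symHeap_spatial (pointsTo_src.comp snd)

theorem symHeap_neqs : Primrec SymHeap.neqs :=
  list_append.comp (list_flatMap symHeap_pures (pureFormula_neqs.comp snd))
    (list_append.comp (list_map symHeap_sources (pair snd (const SLVar.null)))
      (list_orderedPairs.comp symHeap_sources))

end Primrec

namespace PrimrecPred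

variable {α β : Type*} [Primcodable α] [Primcodable β]

theorem exists_mem {f : α → List β} (hf : Primrec f) {p : α → β → Prop} (hp : PrimrecRel p) :
    PrimrecPred fun a => ∃ b ∈ f a, p a b :=
  (PrimrecRel.exists_mem_list hp.swap).comp hf .id

theorem forall_mem {f : α → List β} (hf : Primrec f) {p : α → β → Prop} (hp : PrimrecRel p) :
    PrimrecPred fun a => ∀ b ∈ f a, p a b :=
  (PrimrecRel.forall_mem_list hp.swap).comp hf .id

theorem mem {f : α → List β} (hf : Primrec f) {g : α → β} (hg : Primrec g) :
    PrimrecPred fun a => g a ∈ f a :=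
  (exists_mem hf (p := fun a b => b = g a) (Primrec.eq.comp .snd (hg.comp .fst))).of_eq
    fun a => by simp

end PrimrecPred

/-! ### Decidability of the constraints -/

/-- The pairs of different vertices connected by a path are computed by adding the edges one by
one: a new edge `e` connects everything that leads to its source with everything that can be
reached from its target. -/
def pathClosure {V : Type*} [DecidableEq V] (E : List (V × V)) : List (V × V) :=
  E.foldr (fun e C => C ++
    (e.1 :: C.filterMap fun d => if d.2 = e.1 then some d.1 else none).flatMap fun x =>
      (e.2 :: C.filterMap fun d => if d.1 = e.2 then some d.2 else none).map (Prod.mk x)) []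

theorem edgePath_cons {V : Type*} {e : V × V} {E : List (V × V)} {x y : V} :
    EdgePath (e :: E) x y ↔ EdgePath E x y ∨ EdgePath E x e.1 ∧ EdgePath E e.2 y := by
  have hsub : E ⊆ e :: E := List.subset_cons_self _ _
  refine ⟨fun h => ?_, ?_⟩
  · induction h with
    | refl => exact .inl (.refl _ _)
    | @tail b c _ he ih =>
      rcases List.mem_cons.1 he with rfl | he
      · rcases ih with h | ⟨h, -⟩ <;> exact .inr ⟨h, .refl _ _⟩
      · exact ih.imp (·.trans (.single he)) (And.imp_right (·.trans (.single he)))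
  · rintro (h | ⟨h, h'⟩)
    · exact h.mono hsub
    · exact (h.mono hsub).trans
        ((EdgePath.single (List.mem_cons_self ..)).trans (h'.mono hsub))

theorem edgePath_iff_mem_pathClosure {V : Type*} [DecidableEq V] {E : List (V × V)} {x y : V} :
    EdgePath E x y ↔ x = y ∨ (x, y) ∈ pathClosure E := by
  induction E generalizing x y with
  | nil =>
    simp only [pathClosure, List.foldr_nil, List.not_mem_nil, or_false]
    refine ⟨fun h => ?_, fun h => h ▸ .refl _ _⟩
    induction h with
    | refl => rfl
    | tail _ he => simp at he
  | cons e E ih =>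
    have h : (x, y) ∈ pathClosure (e :: E) ↔ (x, y) ∈ pathClosure E ∨
        (x = e.1 ∨ (x, e.1) ∈ pathClosure E) ∧ (e.2 = y ∨ (e.2, y) ∈ pathClosure E) := by
      rw [pathClosure, List.foldr_cons, ← pathClosure]
      simp [eq_comm (a := y)]
      grind
    rw [edgePath_cons, h, ih, ih, ih]
    tauto

theorem Primrec.pathClosure {V : Type*} [Primcodable V] [DecidableEq V] :
    Primrec (pathClosure (V := V)) := by
  refine list_foldr .id (const []) ?_ (h := fun _ (p : (V × V) × List (V × V)) => p.2 ++
    (p.1.1 :: p.2.filterMap fun d => if d.2 = p.1.1 then some d.1 else none).flatMap fun x =>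
      (p.1.2 :: p.2.filterMap fun d => if d.1 = p.1.2 then some d.2 else none).map (Prod.mk x))
  refine list_append.comp (snd.comp snd) (list_flatMap (list_cons.comp (fst.comp (fst.comp snd))
    (listFilterMap (snd.comp snd) (ite ?_ (option_some.comp (fst.comp snd)) (const none))))
    (list_map (list_cons.comp (snd.comp (fst.comp (snd.comp fst))) (listFilterMap
      (snd.comp (snd.comp fst)) (ite ?_ (option_some.comp (snd.comp snd)) (const none))))
      (pair (snd.comp fst) snd)))
  · exact Primrec.eq.comp (snd.comp snd) (fst.comp (fst.comp (snd.comp fst)))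
  · exact Primrec.eq.comp (fst.comp snd) (snd.comp (fst.comp (snd.comp (fst.comp fst))))

namespace PrimrecPred

variable {α : Type*} [Primcodable α]

theorem edgePath {V : Type*} [Primcodable V] {E : α → List (V × V)} {x y : α → V}
    (hE : Primrec E) (hx : Primrec x) (hy : Primrec y) :
    PrimrecPred fun a => EdgePath (E a) (x a) (y a) := by
  classical
  exact ((Primrec.eq.comp hx hy).or (mem (Primrec.pathClosure.comp hE) (hx.pair hy))).of_eq
    fun a => edgePath_iff_mem_pathClosure.symm

variable {τ : α → SymHeap} (hτ : Primrec τ)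
include hτ

theorem eqv {x y : α → SLVar} (hx : Primrec x) (hy : Primrec y) :
    PrimrecPred fun a => (τ a).Eqv (x a) (y a) :=
  edgePath (Primrec.symHeap_eqEdges.comp hτ) hx hy

theorem reach {x y : α → SLVar} (hx : Primrec x) (hy : Primrec y) :
    PrimrecPred fun a => (τ a).Reach (x a) (y a) :=
  edgePath (Primrec.symHeap_reachEdges.comp hτ) hx hy

theorem alloc {x : α → SLVar} (hx : Primrec x) : PrimrecPred fun a => (τ a).Alloc (x a) :=
  exists_mem (Primrec.symHeap_sources.comp hτ) (eqv (hτ.comp .fst) (hx.comp .fst) .snd)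

theorem neq {x y : α → SLVar} (hx : Primrec x) (hy : Primrec y) :
    PrimrecPred fun a => (τ a).Neq (x a) (y a) :=
  exists_mem (Primrec.symHeap_neqs.comp hτ)
    ((eqv (hτ.comp .fst) (hx.comp .fst) (Primrec.fst.comp .snd)).and
      (eqv (hτ.comp .fst) (hy.comp .fst) (Primrec.snd.comp .snd)))

theorem unsat : PrimrecPred fun a => (τ a).Unsat :=
  exists_mem (Primrec.symHeap_neqs.comp hτ)
    (eqv (hτ.comp .fst) (Primrec.fst.comp .snd) (Primrec.snd.comp .snd))

end PrimrecPred

namespace SymHeap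

/-- A list of the free variables. -/
def freeVarList (τ : SymHeap) : List SLVar :=
  SLVar.null :: (List.range τ.nfv).map SLVar.free

/-- A list of all variables. -/
def varList (τ : SymHeap) : List SLVar :=
  τ.freeVarList ++ (List.range τ.nbv).map SLVar.bound

theorem mem_freeVarList {τ : SymHeap} {x : SLVar} : x ∈ τ.freeVarList ↔ x ∈ τ.freeVars := by
  simp [freeVarList, freeVars, eq_comm (b := x)]

theorem mem_varList {τ : SymHeap} {x : SLVar} : x ∈ τ.varList ↔ x ∈ τ.vars := by
  simp [varList, mem_freeVarList, vars, eq_comm (b := x)]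

theorem _root_.Primrec.symHeap_freeVarList : Primrec freeVarList :=
  Primrec.list_cons.comp (Primrec.const _) (Primrec.list_map
    (Primrec.list_range.comp Primrec.symHeap_nfv) (Primrec.slVar_free.comp Primrec.snd))

theorem _root_.Primrec.symHeap_varList : Primrec varList :=
  Primrec.list_append.comp Primrec.symHeap_freeVarList (Primrec.list_map
    (Primrec.list_range.comp Primrec.symHeap_nbv) (Primrec.slVar_bound.comp Primrec.snd))

theorem primrecPred_covered : PrimrecPred fun τ : SymHeap => τ.Covered τ.freeVars := by
  have h : PrimrecPred fun τ : SymHeap => ∀ y ∈ τ.varList, ∃ x ∈ τ.freeVarList, τ.Reach x y :=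
    .forall_mem Primrec.symHeap_varList (.exists_mem (Primrec.symHeap_freeVarList.comp .fst)
      (.reach (Primrec.fst.comp .fst) .snd (Primrec.snd.comp .fst)))
  exact h.of_eq fun τ => by simp only [Covered, mem_varList, mem_freeVarList]

theorem primrecPred_mem_SH (α : ℕ) : PrimrecPred fun φ : SymHeap => φ ∈ SH α := by
  have hv : PrimrecRel fun (φ : SymHeap) (x : SLVar) => x ∈ φ.vars :=
    (PrimrecPred.mem (Primrec.symHeap_varList.comp .fst) .snd).of_eq fun _ => mem_varList
  have hvs : PrimrecRel fun (φ : SymHeap) (l : List SLVar) => ∀ x ∈ l, x ∈ φ.vars :=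
    PrimrecPred.forall_mem Primrec.snd (hv.comp (Primrec.fst.comp .fst) .snd)
  have hes : PrimrecRel fun (φ : SymHeap) (l : List (SLVar × SLVar)) =>
      ∀ e ∈ l, e.1 ∈ φ.vars ∧ e.2 ∈ φ.vars :=
    PrimrecPred.forall_mem Primrec.snd
      ((hv.comp (Primrec.fst.comp .fst) (Primrec.fst.comp .snd)).and
        (hv.comp (Primrec.fst.comp .fst) (Primrec.snd.comp .snd)))
  have h₁ : PrimrecPred fun φ : SymHeap => ∀ p ∈ φ.spatial, p.src ∈ φ.vars ∧ p.tgt ≠ [] ∧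
      ∀ y ∈ p.tgt, y ∈ φ.vars :=
    .forall_mem Primrec.symHeap_spatial ((hv.comp .fst (Primrec.pointsTo_src.comp .snd)).and
      ((Primrec.eq.comp (Primrec.pointsTo_tgt.comp .snd) (Primrec.const [])).not.and
        (hvs.comp .fst (Primrec.pointsTo_tgt.comp .snd))))
  have h₂ : PrimrecPred fun φ : SymHeap => ∀ c ∈ φ.calls, ∀ y ∈ c.args, y ∈ φ.vars :=
    .forall_mem Primrec.symHeap_calls (hvs.comp .fst (Primrec.predCall_args.comp .snd))
  have h₃ : PrimrecPred fun φ : SymHeap => ∀ π ∈ φ.pures, ∀ e ∈ π.eqEdges,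
      e.1 ∈ φ.vars ∧ e.2 ∈ φ.vars :=
    .forall_mem Primrec.symHeap_pures (hes.comp .fst (Primrec.pureFormula_eqEdges.comp .snd))
  have h₄ : PrimrecPred fun φ : SymHeap => ∀ π ∈ φ.pures, ∀ e ∈ π.neqs,
      e.1 ∈ φ.vars ∧ e.2 ∈ φ.vars :=
    .forall_mem Primrec.symHeap_pures (hes.comp .fst (Primrec.pureFormula_neqs.comp .snd))
  refine ((h₁.and (h₂.and (h₃.and h₄))).and
    (Primrec.nat_le.comp Primrec.symHeap_nfv (Primrec.const α))).of_eq fun φ => ?_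
  refine and_congr_left fun _ => ⟨fun ⟨h₁, h₂, h₃, h₄⟩ => ⟨h₁, h₂, fun x y h => ?_,
    fun x y h => ?_⟩, fun h => ⟨h.spatial_mem, h.calls_mem, fun π hπ e he => ?_,
      fun π hπ e he => ?_⟩⟩
  · exact h₃ _ h (x, y) (by simp [PureFormula.eqEdges])
  · exact h₄ _ h (x, y) (by simp [PureFormula.neqs])
  · exact h.edgesIn_eqEdges e (List.mem_flatMap.2 ⟨π, hπ, he⟩)
  · exact h.edgesIn_neqs e (List.mem_append_left _ (List.mem_flatMap.2 ⟨π, hπ, he⟩))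

end SymHeap

/-! ### The automaton -/

/-- The finitely many properties of a reduced symbolic heap with at most `α` free variables that
are recorded by the states of the automaton. -/
inductive Observation (α : ℕ) where
  | arity (k : Fin (α + 1))
  | eqv (x y : Fin (α + 1))
  | reach (x y : Fin (α + 1))
  | alloc (x : Fin (α + 1))
  | neq (x y : Fin (α + 1))
  | unsat
  | covered
  deriving Fintype

/-- An enumeration of the variables `null, free 0, free 1, …`. -/
def paramVar : ℕ → SLVar
  | 0 => SLVar.null
  | i + 1 => SLVar.free i

namespace Observation

variable {α : ℕ}

/-- The observation is made in `τ`. Observations about parameters that `τ` does not have are never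
made. -/
def Holds (τ : SymHeap) : Observation α → Prop
  | arity k => τ.nfv = k
  | eqv x y => (paramVar x ∈ τ.freeVars ∧ paramVar y ∈ τ.freeVars) ∧
      τ.Eqv (paramVar x) (paramVar y)
  | reach x y => (paramVar x ∈ τ.freeVars ∧ paramVar y ∈ τ.freeVars) ∧
      τ.Reach (paramVar x) (paramVar y)
  | alloc x => paramVar x ∈ τ.freeVars ∧ τ.Alloc (paramVar x)
  | neq x y => (paramVar x ∈ τ.freeVars ∧ paramVar y ∈ τ.freeVars) ∧
      τ.Neq (paramVar x) (paramVar y)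
  | unsat => τ.Unsat
  | covered => τ.Covered τ.freeVars

theorem primrecPred_holds (o : Observation α) : PrimrecPred fun τ : SymHeap => o.Holds τ := by
  have hm (x : SLVar) : PrimrecPred fun τ : SymHeap => x ∈ τ.freeVars :=
    (PrimrecPred.mem Primrec.symHeap_freeVarList (.const x)).of_eq
      fun _ => SymHeap.mem_freeVarList
  cases o with
  | arity k => exact Primrec.eq.comp Primrec.symHeap_nfv (Primrec.const _)
  | eqv x y => exact ((hm _).and (hm _)).and (.eqv .id (.const _) (.const _))
  | reach x y => exact ((hm _).and (hm _)).and (.reach .id (.const _) (.const _))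
  | alloc x => exact (hm _).and (.alloc .id (.const _))
  | neq x y => exact ((hm _).and (hm _)).and (.neq .id (.const _) (.const _))
  | unsat => exact .unsat .id
  | covered => exact SymHeap.primrecPred_covered

theorem exists_paramVar {τ : SymHeap} (hα : τ.nfv ≤ α) {x : SLVar} (hx : x ∈ τ.freeVars) :
    ∃ i : Fin (α + 1), paramVar i = x := by
  rcases hx with rfl | ⟨i, hi, rfl⟩
  · exact ⟨0, rfl⟩
  · exact ⟨⟨i + 1, by omega⟩, rfl⟩

theorem freeVars_eq {τ τ' : SymHeap} (hn : τ.nfv = τ'.nfv) : τ.freeVars = τ'.freeVars := by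
  simp only [SymHeap.freeVars, hn]

/-- Heaps with the same observations simulate each other. -/
theorem simulates {τ τ' : SymHeap} (hα : τ.nfv ≤ α)
    (h : ∀ o : Observation α, o.Holds τ ↔ o.Holds τ') : SymHeap.Simulates τ.freeVars τ τ' := by
  have hF : τ.freeVars = τ'.freeVars :=
    freeVars_eq ((h (arity ⟨τ.nfv, by omega⟩)).1 rfl).symm
  refine ⟨?_, ?_, ?_, ?_, (h unsat).1, fun hc => hF ▸ (h covered).1 hc⟩
  · intro x hx y hy he
    obtain ⟨i, rfl⟩ := exists_paramVar hα hx
    obtain ⟨j, rfl⟩ := exists_paramVar hα hy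
    exact ((h (eqv i j)).1 ⟨⟨hx, hy⟩, he⟩).2
  · intro x hx y hy he
    obtain ⟨i, rfl⟩ := exists_paramVar hα hx
    obtain ⟨j, rfl⟩ := exists_paramVar hα hy
    exact ((h (reach i j)).1 ⟨⟨hx, hy⟩, he⟩).2
  · intro x hx he
    obtain ⟨i, rfl⟩ := exists_paramVar hα hx
    exact ((h (alloc i)).1 ⟨hx, he⟩).2
  · intro x hx y hy he
    obtain ⟨i, rfl⟩ := exists_paramVar hα hx
    obtain ⟨j, rfl⟩ := exists_paramVar hα hy
    exact ((h (neq i j)).1 ⟨⟨hx, hy⟩, he⟩).2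

theorem holds_of_simulates {τ τ' : SymHeap} (hn : τ.nfv = τ'.nfv)
    (h : SymHeap.Simulates τ.freeVars τ τ') (o : Observation α) (ho : o.Holds τ) :
    o.Holds τ' := by
  have hF := freeVars_eq hn
  cases o with
  | arity k => exact hn.symm.trans ho
  | eqv x y => exact ⟨hF ▸ ho.1, h.eqv _ ho.1.1 _ ho.1.2 ho.2⟩
  | reach x y => exact ⟨hF ▸ ho.1, h.reach _ ho.1.1 _ ho.1.2 ho.2⟩
  | alloc x => exact ⟨hF ▸ ho.1, h.alloc _ ho.1 ho.2⟩
  | neq x y => exact ⟨hF ▸ ho.1, h.neq _ ho.1.1 _ ho.1.2 ho.2⟩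
  | unsat => exact h.unsat ho
  | covered =>
    have hc := h.covered ho
    rwa [hF] at hc

end Observation

/-- An enumeration of the sets of observations. -/
noncomputable def stateEquiv (α : ℕ) :
    Set (Observation α) ≃ Fin (Nat.card (Set (Observation α))) :=
  Finite.equivFin _

namespace SymHeap

variable {α : ℕ}

/-- The state of a reduced symbolic heap: the set of its observations. -/
noncomputable def state (α : ℕ) (τ : SymHeap) : Fin (Nat.card (Set (Observation α))) :=
  stateEquiv α {o | o.Holds τ}

theorem state_eq_iff {τ : SymHeap} {p : Fin (Nat.card (Set (Observation α)))} :
    τ.state α = p ↔ ∀ o : Observation α, o.Holds τ ↔ o ∈ (stateEquiv α).symm p := by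
  rw [state, ← Equiv.eq_symm_apply, Set.ext_iff]
  rfl

theorem mem_state_iff {τ : SymHeap} {o : Observation α} :
    o ∈ (stateEquiv α).symm (τ.state α) ↔ o.Holds τ :=
  (state_eq_iff.1 rfl o).symm

theorem state_eq_state_iff {τ τ' : SymHeap} :
    τ.state α = τ'.state α ↔ ∀ o : Observation α, o.Holds τ ↔ o.Holds τ' := by
  simp only [state_eq_iff, mem_state_iff]

theorem primrecPred_state_eq :
    PrimrecRel fun (τ : SymHeap) (p : Fin (Nat.card (Set (Observation α)))) => τ.state α = p := by
  have h (o : Observation α) :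
      PrimrecRel fun (τ : SymHeap) (p : Fin (Nat.card (Set (Observation α)))) =>
        o.Holds τ ↔ o ∈ (stateEquiv α).symm p := by
    classical
    have h₁ : PrimrecPred fun t : SymHeap × Fin (Nat.card (Set (Observation α))) => o.Holds t.1 :=
      o.primrecPred_holds.comp .fst
    have h₂ : PrimrecPred fun t : SymHeap × Fin (Nat.card (Set (Observation α))) =>
        o ∈ (stateEquiv α).symm t.2 :=
      (Primrec.dom_finite fun p => decide (o ∈ (stateEquiv α).symm p)).primrecPred.comp .snd
    exact ((h₁.and h₂).or (h₁.not.and h₂.not)).of_eq fun t => by tauto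
  have hl (l : List (Observation α)) :
      PrimrecRel fun (τ : SymHeap) (p : Fin (Nat.card (Set (Observation α)))) =>
        ∀ o ∈ l, o.Holds τ ↔ o ∈ (stateEquiv α).symm p := by
    induction l with
    | nil => exact ((Primrec.const true).primrecPred (p := fun _ => True)).of_eq fun _ => by simp
    | cons o l ih => exact ((h o).and ih).of_eq fun _ => by simp
  exact (hl Finset.univ.toList).of_eq fun τ p => by simp [state_eq_iff]

theorem simulates_of_state_eq {τ τ' : SymHeap} (hα : τ.nfv ≤ α) (h : τ.state α = τ'.state α) :
    Simulates τ.freeVars τ τ' :=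
  Observation.simulates hα (state_eq_state_iff.1 h)

theorem nfv_eq_of_state_eq {τ τ' : SymHeap} (hα : τ.nfv ≤ α) (h : τ.state α = τ'.state α) :
    τ.nfv = τ'.nfv :=
  ((state_eq_state_iff.1 h (.arity ⟨τ.nfv, by omega⟩)).1 rfl).symm

/-- The state of `φ[P₁ / τ₁, …, Pₘ / τₘ]` depends only on `φ` and on the states of
`τ₁, …, τₘ`. -/
theorem state_replace_eq {φ : SymHeap} (hφ : φ.WellFormed) {τs τs' : List SymHeap}
    (h : Substitutable φ.calls τs) (h' : Substitutable φ.calls τs')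
    (hα : ∀ τ ∈ τs, τ.nfv ≤ α)
    (hs : List.Forall₂ (fun τ τ' => τ.state α = τ'.state α) τs τs') :
    (φ.replace τs).state α = (φ.replace τs').state α := by
  have hn := (replace_wellFormed hφ h).2.2.1
  have hn' := (replace_wellFormed hφ h').2.2.1
  have hs₁ : List.Forall₂ (fun τ τ' => Simulates τ.freeVars τ τ') τs τs' := by
    clear h h' hn hn'
    induction hs with
    | nil => exact .nil
    | cons h _ ih =>
      exact .cons (simulates_of_state_eq (hα _ (by simp)) h)
        (ih fun τ hτ => hα τ (List.mem_cons_of_mem _ hτ))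
  have hs₂ : List.Forall₂ (fun τ τ' => Simulates τ.freeVars τ τ') τs' τs := by
    clear h h' hn hn' hs₁
    induction hs with
    | nil => exact .nil
    | cons h _ ih =>
      have hα₁ := hα _ List.mem_cons_self
      exact .cons (simulates_of_state_eq (nfv_eq_of_state_eq hα₁ h ▸ hα₁) h.symm)
        (ih fun τ hτ => hα τ (List.mem_cons_of_mem _ hτ))
  refine state_eq_state_iff.2 fun o => ⟨?_, ?_⟩
  · refine Observation.holds_of_simulates (hn.trans hn'.symm) ?_ o
    rw [Observation.freeVars_eq hn]
    exact Simulates.replace hφ h hs₁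
  · refine Observation.holds_of_simulates (hn'.trans hn.symm) ?_ o
    rw [Observation.freeVars_eq hn']
    exact Simulates.replace hφ h' hs₂

theorem replace_nil {τ : SymHeap} (h : τ.calls = []) : τ.replace [] = τ := by
  cases τ
  subst h
  rfl

open Classical in
/-- A reduced symbolic heap in the given state; for states that do not occur, any symbolic heap. -/
noncomputable def representative (p : Fin (Nat.card (Set (Observation α)))) : SymHeap :=
  if h : ∃ τ ∈ RSH α, τ.state α = p then h.choose else ⟨0, 0, [], [], []⟩

theorem representative_spec {τ : SymHeap} (h : τ ∈ RSH α) :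
    representative (τ.state α) ∈ RSH α ∧ (representative (τ.state α)).state α = τ.state α := by
  have h' : ∃ τ' ∈ RSH α, τ'.state α = τ.state α := ⟨τ, h, rfl⟩
  rw [representative, dif_pos h']
  exact h'.choose_spec

theorem mem_RSH_of_forall₂ {cs : List PredCall} {τs : List SymHeap}
    (h : List.Forall₂ (fun (c : PredCall) (τ : SymHeap) => τ ∈ RSH α ∧ τ.nfv = c.args.length)
      cs τs) : ∀ τ ∈ τs, τ ∈ RSH α := by
  induction h with
  | nil => simp
  | cons h _ ih => exact List.forall_mem_cons.2 ⟨h.1, ih⟩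

theorem state_replace_representative {φ : SymHeap} (hφ : φ ∈ SH α) {τs : List SymHeap}
    (h : List.Forall₂ (fun (c : PredCall) (τ : SymHeap) => τ ∈ RSH α ∧ τ.nfv = c.args.length)
      φ.calls τs) :
    (φ.replace ((τs.map (state α)).map representative)).state α = (φ.replace τs).state α := by
  have hφ' := hφ.1
  symm
  refine state_replace_eq hφ' (h.imp fun c τ hτ => ⟨hτ.1.1.1, hτ.1.2, hτ.2⟩) ?_ ?_ ?_
  · rw [List.map_map, Substitutable, List.forall₂_map_right_iff]
    refine h.imp fun c τ hτ => ?_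
    obtain ⟨h₁, h₂⟩ := representative_spec hτ.1
    exact ⟨h₁.1.1, h₁.2, (nfv_eq_of_state_eq h₁.1.2 h₂).trans hτ.2⟩
  · exact fun τ hτ => (mem_RSH_of_forall₂ h τ hτ).1.2
  · rw [List.map_map, List.forall₂_map_right_iff, List.forall₂_same]
    exact fun τ hτ => (representative_spec (mem_RSH_of_forall₂ h τ hτ)).2.symm

end SymHeap

/-- The automaton computes the state of a symbolic heap from those of the heaps which replace its
predicate calls, by replacing representatives of these states instead. A state is final if it
belongs to heaps that are contradictory or all of whose variables are reachable. -/
noncomputable def garbageFreeAutomaton (α : ℕ) : HeapAutomaton α where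
  numStates := Nat.card (Set (Observation α))
  final := {p | .unsat ∈ (stateEquiv α).symm p ∨ .covered ∈ (stateEquiv α).symm p}
  Δ q φ p := φ ∈ SH α ∧ q.length = φ.calls.length ∧
    (φ.replace (q.map SymHeap.representative)).state α = p
  Δ_mem _ _ _ h := h.1
  Δ_length _ _ _ h := h.2.1
  Δ_decidable := by
    refine PrimrecPred.computablePred (((SymHeap.primrecPred_mem_SH α).comp
      (Primrec.fst.comp .snd)).and (.and (Primrec.eq.comp (Primrec.list_length.comp .fst)
        (Primrec.list_length.comp (Primrec.symHeap_calls.comp (Primrec.fst.comp .snd)))) ?_))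
    exact SymHeap.primrecPred_state_eq.comp
      (Primrec.symHeap_replace (Primrec.fst.comp .snd)
        -- A function on the finite set of states is computable.
        (Primrec.list_map .fst ((Primrec.dom_finite SymHeap.representative).comp .snd)))
      (Primrec.snd.comp .snd)

theorem garbageFreeAutomaton_nil_iff {α : ℕ} {τ : SymHeap} (h : τ ∈ RSH α)
    {p : Fin (garbageFreeAutomaton α).numStates} :
    (garbageFreeAutomaton α).Δ [] τ p ↔ τ.state α = p := by
  simp [garbageFreeAutomaton, h.1, h.2, SymHeap.replace_nil h.2]

theorem garbageFreeAutomaton_compositional (α : ℕ) :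
    (garbageFreeAutomaton α).Compositional := by
  intro p φ τs hφ h
  have hS : SymHeap.Substitutable φ.calls τs := h.imp fun c τ hτ => ⟨hτ.1.1.1, hτ.1.2, hτ.2⟩
  have hmem : φ.replace τs ∈ RSH α := by
    obtain ⟨h₁, h₂, h₃, -⟩ := SymHeap.replace_wellFormed hφ.1 hS
    exact ⟨⟨h₁, h₃.le.trans hφ.2⟩, h₂⟩
  have hτ := SymHeap.mem_RSH_of_forall₂ h
  have key : (garbageFreeAutomaton α).Δ (τs.map (SymHeap.state α)) φ p ↔
      (φ.replace τs).state α = p := by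
    rw [← SymHeap.state_replace_representative hφ h]
    simp [garbageFreeAutomaton, hφ, h.length_eq]
  rw [garbageFreeAutomaton_nil_iff hmem, ← key]
  constructor
  · rintro ⟨q, hq, hqs⟩
    -- The states of the replacing heaps are determined.
    suffices q = τs.map (SymHeap.state α) from this ▸ hq
    clear hq key hmem hS h
    induction hqs with
    | nil => rfl
    | @cons τ r τs q hr _ ih =>
      rw [List.map_cons, ← ih fun τ h => hτ τ (List.mem_cons_of_mem _ h),
        (garbageFreeAutomaton_nil_iff (hτ τ List.mem_cons_self)).1 hr]
      rfl
  · exact fun hq => ⟨_, hq, List.forall₂_map_right_iff.2 (List.forall₂_same.2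
      fun τ hm => (garbageFreeAutomaton_nil_iff (hτ τ hm)).2 rfl)⟩

theorem garbageFreeAutomaton_language (α : ℕ) :
    (garbageFreeAutomaton α).language = GFREE α := by
  ext τ
  refine and_congr_right fun h => ?_
  have hfinal : τ.state α ∈ (garbageFreeAutomaton α).final ↔
      τ.Unsat ∨ τ.Covered τ.freeVars :=
    or_congr SymHeap.mem_state_iff SymHeap.mem_state_iff
  rw [SymHeap.garbageFree_iff h.1.1, ← hfinal]
  constructor
  · rintro ⟨q, hq, hΔ⟩
    exact (garbageFreeAutomaton_nil_iff h).1 hΔ ▸ hq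
  · exact fun hq => ⟨_, hq, (garbageFreeAutomaton_nil_iff h).2 rfl⟩

theorem mainTheorem7 (α : ℕ) :
    ∃ A : HeapAutomaton α, A.Compositional ∧ A.language = GFREE α :=
  ⟨garbageFreeAutomaton α, garbageFreeAutomaton_compositional α, garbageFreeAutomaton_language α⟩
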